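/- Let $n\ge 1$, let $\mathcal C$ be an additive category, $\mathbb E\colon\mathcal C^{\rm op}\times\mathcal C\to \mathrm{Ab}$ an additive bifunctor, and let $(\mathcal C,\mathbb E,\mathfrak s)$ be an $n$-exangulated category in the sense of Herschend–Liu–Nakaoka. A pair $\langle X^\bullet,\delta\rangle$ with $X^\bullet\colon X^0\to X^1\to\cdots\to X^{n+1}$ and $\delta\in\mathbb E(X^{n+1},X^0)$ is a distinguished $n$-exangle if $\mathfrak s(\delta)=[X^\bullet]$. Then $d_X^0$ is called an inflation and $d_X^n$ a deflation; the inflations (deflations) that arise from a member of a class $\xi$ of distinguished $n$-exangles are called $\xi$-inflations ($\xi$-deflations). A morphism $f^\bullet\colon\langle X^\bullet,\delta\rangle\to\langle Y^\bullet,\rho\rangle$ of distinguished $n$-exangles (a morphism of complexes with $(f^0)_*\delta=(f^{n+1})^*\rho$) is a weak isomorphism if $f^0$ and $f^{n+1}$ are isomorphisms. A class $\xi$ of distinguished $n$-exangles is $n$-proper if (i) it contains every distinguished $n$-exangle $\langle X^\bullet,0\rangle$, and is closed under weak isomorphisms and finite coproducts; (ii) it is closed under base change and cobase change: if $\langle X^\bullet,\delta\rangle\in\xi$,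 with $\delta\in\mathbb E(C,A)$, then for all $c\colon C'\to C$ and $a\colon A\to A'$ every distinguished $n$-exangle $\langle Y^\bullet,c^*\delta\rangle$ and every distinguished $n$-exangle $\langle Y^\bullet,a_*\delta\rangle$ belongs to $\xi$; (iii) it is saturated: whenever $ba=dc$ with $a\colon A\to B$, $b\colon B\to D$, $c\colon A\to C$, $d\colon C\to D$, where $a,b,d$ are deflations and $a,b$ are $\xi$-deflations, then $d$ is a $\xi$-deflation. Put $\mathbb E_\xi(C,A)=\{\delta\in\mathbb E(C,A)\mid \langle X^\bullet,\delta\rangle\in\xi\text{ for some }X^\bullet\}$ and $\mathfrak s_\xi=\mathfrak s|_{\mathbb E_\xi}$. Saying that $(\mathcal C,\mathbb E_\xi,\mathfrak s_\xi)$ is $n$-exangulated or $n$-exact includes that $\mathbb E_\xi$ is an additive sub-bifunctor of $\mathbb E$. An $n$-exangulated category is said to be $n$-exact if it is the one induced by an $n$-exact structure in the sense of Jasso: its conflations are the admissible $n$-exact sequences of such a structure, and $\delta\mapsto\mathfrak s(\delta)$ identifies $\mathbb E(C,A)$ with the homotopy classes of admissible $n$-exact sequences from $A$ to $C$. It is said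 to be $(n+2)$-angulated if it is the one induced by an $(n+2)$-angulated category $(\mathcal C,\Sigma,\Theta)$ in the sense of Geiss–Keller–Oppermann: $\mathbb E(C,A)\cong\mathcal C(C,\Sigma A)$ naturally, and under this isomorphism the distinguished $n$-exangles are the $(n+2)$-angles. A class of admissible $n$-exact sequences, respectively of $(n+2)$-angles, is called closed under weak isomorphisms, or $n$-proper, if the class of distinguished $n$-exangles it induces is so; $\mathbb E_\xi$ and $\mathfrak s_\xi$ are formed with this induced class. (1) If $(\mathcal C,\mathbb E,\mathfrak s)$ is an $n$-exact category and $\xi$ is a class of (admissible) $n$-exact sequences which is closed under weak isomorphisms, then $\xi$ is $n$-proper if and only if $(\mathcal C,\mathbb E_\xi,\mathfrak s_\xi)$ is an $n$-exact category. (2) If $(\mathcal C,\mathbb E,\mathfrak s)$ is an $(n+2)$-angulated category and $\xi$ is a class of $(n+2)$-angles which is closed under weak isomorphisms, then $\xi$ is $n$-proper if and only if $(\mathcal C,\mathbb E_\xi,\mathfrak s_\xi)$ is an $n$-exangulated category. -/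

import Mathlib

open CategoryTheory CategoryTheory.Limits Opposite

universe w v u

namespace NExang

variable {𝓒 : Type u} [Category.{v} 𝓒] [Preadditive 𝓒]

/-! ## Sequences `X⁰ ⟶ X¹ ⟶ ⋯ ⟶ Xⁿ⁺¹` with given ends -/

/-- A complex `X⁰ ⟶ X¹ ⟶ ⋯ ⟶ Xⁿ⁺¹` in `𝓒` (a cochain complex which vanishes outside of the degrees
`0, …, n + 1`) whose end terms are identified with `A` and `C`. Identifying the ends through the
isomorphisms `α`, `γ`, in place of an equality of objects, gives a category equivalent to the
category of complexes with `X⁰ = A` and `Xⁿ⁺¹ = C` and morphisms that are the identity in the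
degrees `0` and `n + 1`; the two have the same homotopy classes. -/
structure NSeq (n : ℕ) (A C : 𝓒) where
  /-- the underlying complex -/
  K : CochainComplex 𝓒 ℕ
  isZero : ∀ i, n + 1 < i → IsZero (K.X i)
  /-- the identification of the first term -/
  α : K.X 0 ≅ A
  /-- the identification of the last term -/
  γ : K.X (n + 1) ≅ C

namespace NSeq

variable {n : ℕ}

/-- The first differential `d⁰ : A ⟶ X¹`. -/
def inf {A C : 𝓒} (X : NSeq n A C) : A ⟶ X.K.X 1 := X.α.inv ≫ X.K.d 0 1

/-- The last differential `dⁿ : Xⁿ ⟶ C`. -/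
def defl {A C : 𝓒} (X : NSeq n A C) : X.K.X n ⟶ C := X.K.d n (n + 1) ≫ X.γ.hom

/-- The morphism of complexes `f` is of the form `(a, f¹, …, fⁿ, c)`. -/
structure Lifts {A C A' C' : 𝓒} {X : NSeq n A C} {Y : NSeq n A' C'} (f : X.K ⟶ Y.K)
    (a : A ⟶ A') (c : C ⟶ C') : Prop where
  left : f.f 0 ≫ Y.α.hom = X.α.hom ≫ a
  right : f.f (n + 1) ≫ Y.γ.hom = X.γ.hom ≫ c

/-- Homotopy equivalence of complexes with the same ends, through morphisms that are the identity
at both ends; the homotopies are the usual homotopies of complexes. -/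
def HtpyEquiv {A C : 𝓒} (X Y : NSeq n A C) : Prop :=
  ∃ e : HomotopyEquiv X.K Y.K,
    Lifts (X := X) (Y := Y) e.hom (𝟙 A) (𝟙 C) ∧ Lifts (X := Y) (Y := X) e.inv (𝟙 A) (𝟙 C)

theorem Lifts.comp {A C : 𝓒} {X Y Z : NSeq n A C} {f : X.K ⟶ Y.K} {g : Y.K ⟶ Z.K}
    (hf : Lifts (X := X) (Y := Y) f (𝟙 A) (𝟙 C)) (hg : Lifts (X := Y) (Y := Z) g (𝟙 A) (𝟙 C)) :
    Lifts (X := X) (Y := Z) (f ≫ g) (𝟙 A) (𝟙 C) := by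
  constructor
  · have h1 := hf.left
    have h2 := hg.left
    simp only [Category.comp_id] at h1 h2 ⊢
    simp [h1, h2]
  · have h1 := hf.right
    have h2 := hg.right
    simp only [Category.comp_id] at h1 h2 ⊢
    simp [h1, h2]

/-- Homotopy equivalence as a setoid. -/
instance htpySetoid (n : ℕ) (A C : 𝓒) : Setoid (NSeq n A C) where
  r := HtpyEquiv
  iseqv :=
    { refl := fun X => ⟨HomotopyEquiv.refl X.K, ⟨by simp [HomotopyEquiv.refl],
        by simp [HomotopyEquiv.refl]⟩, ⟨by simp [HomotopyEquiv.refl], by simp [HomotopyEquiv.refl]⟩⟩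
      symm := fun ⟨e, h1, h2⟩ => ⟨e.symm, h2, h1⟩
      trans := fun ⟨e, h1, h2⟩ ⟨e', h1', h2'⟩ => ⟨e.trans e', h1.comp h1', h2'.comp h2⟩ }

/-- The direct sum of two sequences. -/
noncomputable def sum [HasBinaryBiproducts 𝓒] {A C A' C' : 𝓒}
    (X : NSeq n A C) (Y : NSeq n A' C') : NSeq n (A ⊞ A') (C ⊞ C') where
  K := X.K ⊞ Y.K
  isZero := fun i hi => by
    refine IsZero.of_iso ?_ (HomologicalComplex.biprodXIso X.K Y.K i)
    rw [IsZero.iff_id_eq_zero]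
    apply biprod.hom_ext'
    · exact (X.isZero i hi).eq_of_src _ _
    · exact (Y.isZero i hi).eq_of_src _ _
  α := HomologicalComplex.biprodXIso X.K Y.K 0 ≪≫ biprod.mapIso X.α Y.α
  γ := HomologicalComplex.biprodXIso X.K Y.K (n + 1) ≪≫ biprod.mapIso X.γ Y.γ

end NSeq

/-- The set of homotopy classes of sequences from `A` to `C`. -/
abbrev HoClass (n : ℕ) (A C : 𝓒) := Quotient (NSeq.htpySetoid n A C)

/-- A class of sequences. -/
abbrev SeqClass (𝓒 : Type u) [Category.{v} 𝓒] [Preadditive 𝓒] (n : ℕ) :=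
  ∀ ⦃A C : 𝓒⦄, NSeq n A C → Prop

/-- `f = d⁰` for some sequence of the class `𝒳`. -/
def IsInflation {n : ℕ} (𝒳 : SeqClass 𝓒 n) {A B : 𝓒} (f : A ⟶ B) : Prop :=
  ∃ (C : 𝓒) (X : NSeq n A C) (e : X.K.X 1 ≅ B), 𝒳 X ∧ X.inf ≫ e.hom = f

/-- `g = dⁿ` for some sequence of the class `𝒳`. -/
def IsDeflation {n : ℕ} (𝒳 : SeqClass 𝓒 n) {B C : 𝓒} (g : B ⟶ C) : Prop :=
  ∃ (A : 𝓒) (X : NSeq n A C) (e : X.K.X n ≅ B), 𝒳 X ∧ e.inv ≫ X.defl = g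

/-- `𝓒(W, K⁰) ⟶ ⋯ ⟶ 𝓒(W, Kⁿ⁺¹)` is exact at the places `1, …, n`, for every `W`. -/
def CovExact (n : ℕ) (K : CochainComplex 𝓒 ℕ) : Prop :=
  ∀ (W : 𝓒) (i : ℕ), i < n → ∀ g : W ⟶ K.X (i + 1), g ≫ K.d (i + 1) (i + 2) = 0 →
    ∃ k : W ⟶ K.X i, k ≫ K.d i (i + 1) = g

/-- `𝓒(Kⁿ⁺¹, W) ⟶ ⋯ ⟶ 𝓒(K⁰, W)` is exact at the places `n, …, 1`, for every `W`. -/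
def ContraExact (n : ℕ) (K : CochainComplex 𝓒 ℕ) : Prop :=
  ∀ (W : 𝓒) (i : ℕ), i < n → ∀ g : K.X (i + 1) ⟶ W, K.d i (i + 1) ≫ g = 0 →
    ∃ k : K.X (i + 2) ⟶ W, K.d (i + 1) (i + 2) ≫ k = g

/-! ## Mapping cones and cocones -/

/-- The mapping cone
`K¹ ⟶ K² ⊕ L¹ ⟶ K³ ⊕ L² ⟶ ⋯ ⟶ Kⁿ⁺¹ ⊕ Lⁿ ⟶ Lⁿ⁺¹`
of `f : K ⟶ L`, given up to isomorphism by the decomposition of its terms. The differentials are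
`(-d ; f)`, then `(-d 0 ; f d)`, and at last `(f d)`. -/
structure MappingCone [HasBinaryBiproducts 𝓒] (n : ℕ) {K L : CochainComplex 𝓒 ℕ} (f : K ⟶ L) where
  /-- the underlying sequence -/
  seq : NSeq n (K.X 1) (L.X (n + 1))
  /-- the decomposition of the terms in the degrees `1, …, n` -/
  e : ∀ i : ℕ, 1 ≤ i → i ≤ n → (seq.K.X i ≅ K.X (i + 1) ⊞ L.X i)
  inf_comm : ∀ h : 1 ≤ n,
    seq.inf ≫ (e 1 le_rfl h).hom = biprod.lift (-K.d 1 2) (f.f 1)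
  d_comm : ∀ (i : ℕ) (h₁ : 1 ≤ i) (h₂ : i + 1 ≤ n),
    seq.K.d i (i + 1) ≫ (e (i + 1) (Nat.le_add_left 1 i) h₂).hom =
      (e i h₁ (Nat.le_of_succ_le h₂)).hom ≫
        biprod.desc (biprod.lift (-K.d (i + 1) (i + 2)) (f.f (i + 1)))
          (biprod.lift 0 (L.d i (i + 1)))
  defl_comm : ∀ h : 1 ≤ n,
    seq.defl = (e n h le_rfl).hom ≫ biprod.desc (f.f (n + 1)) (L.d n (n + 1))

/-- The mapping cocone
`K⁰ ⟶ K¹ ⊕ L⁰ ⟶ K² ⊕ L¹ ⟶ ⋯ ⟶ Kⁿ ⊕ Lⁿ⁻¹ ⟶ Lⁿ`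
of `h : K ⟶ L`, given up to isomorphism by the decomposition of its terms. The differentials are
`(d ; h)`, then `(d 0 ; h -d)`, and at last `(h -d)`; this is the mapping cone formed in the
opposite category. Only the degrees `0, …, n` of `h` enter. -/
structure MappingCocone [HasBinaryBiproducts 𝓒] (n : ℕ) {K L : CochainComplex 𝓒 ℕ}
    (h : K ⟶ L) where
  /-- the underlying sequence -/
  seq : NSeq n (K.X 0) (L.X n)
  /-- the decomposition of the terms in the degrees `1, …, n` -/
  e : ∀ i j : ℕ, i + 1 = j → j ≤ n → (seq.K.X j ≅ K.X j ⊞ L.X i)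
  inf_comm : ∀ h₁ : 1 ≤ n,
    seq.inf ≫ (e 0 1 rfl h₁).hom = biprod.lift (K.d 0 1) (h.f 0)
  d_comm : ∀ (i : ℕ) (h₂ : i + 2 ≤ n),
    seq.K.d (i + 1) (i + 2) ≫ (e (i + 1) (i + 2) rfl h₂).hom =
      (e i (i + 1) rfl (Nat.le_of_succ_le h₂)).hom ≫
        biprod.desc (biprod.lift (K.d (i + 1) (i + 2)) (h.f (i + 1)))
          (biprod.lift 0 (-L.d i (i + 1)))
  defl_comm : ∀ (i : ℕ) (hi : i + 1 = n),
    seq.defl = (e i n hi le_rfl).hom ≫ biprod.desc (h.f n) (-L.d i n)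

/-! ## Extensions and realizations -/

/-- The group `𝔼(C, A)` of extensions. -/
abbrev Ext (E : 𝓒ᵒᵖ ⥤ 𝓒 ⥤ AddCommGrpCat.{w}) (C A : 𝓒) : Type w := (E.obj (op C)).obj A

/-- `a_* δ`. -/
def push (E : 𝓒ᵒᵖ ⥤ 𝓒 ⥤ AddCommGrpCat.{w}) {C A A' : 𝓒} (a : A ⟶ A') (δ : Ext E C A) :
    Ext E C A' :=
  (E.obj (op C)).map a δ

/-- `c^* δ`. -/
def pull (E : 𝓒ᵒᵖ ⥤ 𝓒 ⥤ AddCommGrpCat.{w}) {C C' A : 𝓒} (c : C' ⟶ C) (δ : Ext E C A) :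
    Ext E C' A :=
  (E.map c.op).app A δ

/-- `δ ⊕ δ'`. -/
noncomputable def extSum [HasBinaryBiproducts 𝓒] (E : 𝓒ᵒᵖ ⥤ 𝓒 ⥤ AddCommGrpCat.{w})
    {A C A' C' : 𝓒} (δ : Ext E C A) (δ' : Ext E C' A') : Ext E (C ⊞ C') (A ⊞ A') :=
  pull E biprod.fst (push E biprod.inl δ) + pull E biprod.snd (push E biprod.inr δ')

/-- A correspondence that associates a homotopy class of sequences from `A` to `C` to each
extension `δ ∈ 𝔼(C, A)`. -/
abbrev Corr (n : ℕ) (E : 𝓒ᵒᵖ ⥤ 𝓒 ⥤ AddCommGrpCat.{w}) :=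
  ∀ ⦃A C : 𝓒⦄, Ext E C A → HoClass n A C

/-- The pair `⟨X, δ⟩` is an `n`-exangle. -/
structure IsExangle (E : 𝓒ᵒᵖ ⥤ 𝓒 ⥤ AddCommGrpCat.{w}) {n : ℕ} {A C : 𝓒}
    (X : NSeq n A C) (δ : Ext E C A) : Prop where
  cov : CovExact n X.K
  cov_last : ∀ (W : 𝓒) (g : W ⟶ C), pull E g δ = 0 ↔ ∃ k : W ⟶ X.K.X n, k ≫ X.defl = g
  contra : ContraExact n X.K
  contra_last : ∀ (W : 𝓒) (g : A ⟶ W), push E g δ = 0 ↔ ∃ k : X.K.X 1 ⟶ W, X.inf ≫ k = g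

/-- The class of conflations: the sequences that realize some extension. -/
def Conf {n : ℕ} {E : 𝓒ᵒᵖ ⥤ 𝓒 ⥤ AddCommGrpCat.{w}} (s : Corr n E) : SeqClass 𝓒 n :=
  fun _ _ X => ∃ δ, s δ = ⟦X⟧

/-- `(𝓒, E, s)` is an `n`-exangulated category. -/
structure IsNExangulated [HasBinaryBiproducts 𝓒] (n : ℕ) (E : 𝓒ᵒᵖ ⥤ 𝓒 ⥤ AddCommGrpCat.{w})
    (s : Corr n E) : Prop where
  /-- `E` is an additive bifunctor -/
  additive_left : E.Additive
  additive_right : ∀ C : 𝓒, (E.obj (op C)).Additive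
  /-- (R0) every morphism of extensions has a lift -/
  exists_lift : ∀ {A C A' C' : 𝓒} (δ : Ext E C A) (ρ : Ext E C' A') (X : NSeq n A C)
    (Y : NSeq n A' C'), s δ = ⟦X⟧ → s ρ = ⟦Y⟧ → ∀ (a : A ⟶ A') (c : C ⟶ C'),
    push E a δ = pull E c ρ → ∃ f : X.K ⟶ Y.K, NSeq.Lifts (X := X) (Y := Y) f a c
  /-- (R1) -/
  exangle : ∀ {A C : 𝓒} (δ : Ext E C A) (X : NSeq n A C), s δ = ⟦X⟧ → IsExangle E X δ
  /-- (R2) `s(0) = [A = A ⟶ 0 ⟶ ⋯ ⟶ 0]` for `0 ∈ 𝔼(0, A)` -/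
  split_left : ∀ {A Z : 𝓒} (_ : IsZero Z) (X : NSeq n A Z), IsIso X.inf →
    (∀ i, 2 ≤ i → IsZero (X.K.X i)) → s (0 : Ext E Z A) = ⟦X⟧
  /-- (R2), dual: `s(0) = [0 ⟶ ⋯ ⟶ 0 ⟶ A = A]` for `0 ∈ 𝔼(A, 0)` -/
  split_right : ∀ {A Z : 𝓒} (_ : IsZero Z) (X : NSeq n Z A), IsIso X.defl →
    (∀ i, i < n → IsZero (X.K.X i)) → s (0 : Ext E A Z) = ⟦X⟧
  /-- (EA1) -/
  inflation_comp : ∀ {A B C : 𝓒} (f : A ⟶ B) (g : B ⟶ C),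
    IsInflation (Conf s) f → IsInflation (Conf s) g → IsInflation (Conf s) (f ≫ g)
  deflation_comp : ∀ {A B C : 𝓒} (f : A ⟶ B) (g : B ⟶ C),
    IsDeflation (Conf s) f → IsDeflation (Conf s) g → IsDeflation (Conf s) (f ≫ g)
  /-- (EA2) `(1, c)` has a lift whose mapping cone realizes `(d⁰_X)_* ρ` -/
  good_lift : ∀ {A C D : 𝓒} (ρ : Ext E D A) (c : C ⟶ D) (X : NSeq n A C) (Y : NSeq n A D),
    s (pull E c ρ) = ⟦X⟧ → s ρ = ⟦Y⟧ →
    ∃ f : X.K ⟶ Y.K, NSeq.Lifts (X := X) (Y := Y) f (𝟙 A) c ∧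
      ∃ M : MappingCone n f, s (push E X.inf (pull E Y.γ.hom ρ)) = ⟦M.seq⟧
  /-- (EA2) in the opposite category: `(a, 1)` has a lift whose mapping cocone realizes
  `(dⁿ_Y)^* ρ` -/
  good_lift_op : ∀ {A B C : 𝓒} (ρ : Ext E C A) (a : A ⟶ B) (X : NSeq n A C) (Y : NSeq n B C),
    s ρ = ⟦X⟧ → s (push E a ρ) = ⟦Y⟧ →
    ∃ h : X.K ⟶ Y.K, NSeq.Lifts (X := X) (Y := Y) h a (𝟙 C) ∧
      ∃ N : MappingCocone n h, s (push E X.α.inv (pull E Y.defl ρ)) = ⟦N.seq⟧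

/-! ## Additive subfunctors of `𝔼` -/

/-- An additive sub-bifunctor of `E`. -/
structure AddSubBifunctor (E : 𝓒ᵒᵖ ⥤ 𝓒 ⥤ AddCommGrpCat.{w}) where
  /-- the subgroups -/
  grp : ∀ C A : 𝓒, AddSubgroup (Ext E C A)
  push_mem : ∀ {C A A' : 𝓒} (a : A ⟶ A') (δ : Ext E C A), δ ∈ grp C A → push E a δ ∈ grp C A'
  pull_mem : ∀ {C C' A : 𝓒} (c : C' ⟶ C) (δ : Ext E C A), δ ∈ grp C A → pull E c δ ∈ grp C' A

namespace AddSubBifunctor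

variable {E : 𝓒ᵒᵖ ⥤ 𝓒 ⥤ AddCommGrpCat.{w}} (F : AddSubBifunctor E)

/-- The bifunctor given by the subgroups. -/
def toBifunctor : 𝓒ᵒᵖ ⥤ 𝓒 ⥤ AddCommGrpCat.{w} where
  obj C :=
    { obj := fun A => AddCommGrpCat.of (F.grp C.unop A)
      map := fun {A A'} a => AddCommGrpCat.ofHom
        ((((E.obj C).map a).hom.comp (F.grp C.unop A).subtype).codRestrict (F.grp C.unop A')
          (fun δ => F.push_mem a δ.1 δ.2))
      map_id := fun A => by ext δ; simp
      map_comp := fun a b => by ext δ; simp; rfl }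
  map {C C'} c :=
    { app := fun A => AddCommGrpCat.ofHom
        ((((E.map c).app A).hom.comp (F.grp C.unop A).subtype).codRestrict (F.grp C'.unop A)
          (fun δ => F.pull_mem c.unop δ.1 δ.2))
      naturality := fun A A' a => by
        ext δ
        exact NatTrans.naturality_apply (E.map c) a δ.1 }
  map_id C := by ext A δ; simp
  map_comp c c' := by ext A δ; simp; rfl

/-- The restriction of `s` to the subfunctor. -/
def restrict {n : ℕ} (s : Corr n E) : Corr n F.toBifunctor :=
  fun A C (δ : F.grp C A) => s δ.1

end AddSubBifunctor

/-! ## Classes of distinguished `n`-exangles and `n`-proper classes -/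

/-- A class of pairs `⟨X, δ⟩`. -/
abbrev ExangleClass (n : ℕ) (E : 𝓒ᵒᵖ ⥤ 𝓒 ⥤ AddCommGrpCat.{w}) :=
  ∀ ⦃A C : 𝓒⦄, NSeq n A C → Ext E C A → Prop

section Proper

variable {n : ℕ} {E : 𝓒ᵒᵖ ⥤ 𝓒 ⥤ AddCommGrpCat.{w}}

/-- The sequences that underlie a member of `ξ`. -/
def ExangleClass.seqs (ξ : ExangleClass n E) : SeqClass 𝓒 n := fun _ _ X => ∃ δ, ξ X δ

/-- `ξ` is closed under weak isomorphisms, that is, under morphisms `f` of distinguished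
`n`-exangles such that `f⁰` and `fⁿ⁺¹` are isomorphisms. -/
def ClosedUnderWeakIso (s : Corr n E) (ξ : ExangleClass n E) : Prop :=
  ∀ {A C A' C' : 𝓒} (X : NSeq n A C) (δ : Ext E C A) (Y : NSeq n A' C') (ρ : Ext E C' A'),
    s δ = ⟦X⟧ → s ρ = ⟦Y⟧ →
    ∀ (f : X.K ⟶ Y.K) (a : A ⟶ A') (c : C ⟶ C'), NSeq.Lifts (X := X) (Y := Y) f a c →
      push E a δ = pull E c ρ → IsIso a → IsIso c → (ξ X δ ↔ ξ Y ρ)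

/-- `ξ` is an `n`-proper class of distinguished `n`-exangles of `(𝓒, E, s)`. -/
structure IsNProper [HasBinaryBiproducts 𝓒] (s : Corr n E) (ξ : ExangleClass n E) : Prop where
  distinguished : ∀ {A C : 𝓒} (X : NSeq n A C) (δ : Ext E C A), ξ X δ → s δ = ⟦X⟧
  split_mem : ∀ {A C : 𝓒} (X : NSeq n A C), s (0 : Ext E C A) = ⟦X⟧ → ξ X (0 : Ext E C A)
  weakIso : ClosedUnderWeakIso s ξ
  sum_mem : ∀ {A C A' C' : 𝓒} (X : NSeq n A C) (δ : Ext E C A) (Y : NSeq n A' C')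
    (ρ : Ext E C' A'), ξ X δ → ξ Y ρ → ξ (X.sum Y) (extSum E δ ρ)
  base_change : ∀ {A C C' : 𝓒} (X : NSeq n A C) (δ : Ext E C A) (c : C' ⟶ C) (Y : NSeq n A C'),
    ξ X δ → s (pull E c δ) = ⟦Y⟧ → ξ Y (pull E c δ)
  cobase_change : ∀ {A A' C : 𝓒} (X : NSeq n A C) (δ : Ext E C A) (a : A ⟶ A') (Y : NSeq n A' C),
    ξ X δ → s (push E a δ) = ⟦Y⟧ → ξ Y (push E a δ)
  saturated : ∀ {A B C D : 𝓒} (a : A ⟶ B) (b : B ⟶ D) (c : A ⟶ C) (d : C ⟶ D), a ≫ b = c ≫ d →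
    IsDeflation (Conf s) a → IsDeflation (Conf s) b → IsDeflation (Conf s) d →
    IsDeflation ξ.seqs a → IsDeflation ξ.seqs b → IsDeflation ξ.seqs d

/-- The subfunctor `F` is `E_ξ`: its elements are the extensions that are realized by a member
of `ξ`. -/
def IsSubfunctorOf (ξ : ExangleClass n E) (F : AddSubBifunctor E) : Prop :=
  ∀ (A C : 𝓒) (δ : Ext E C A), δ ∈ F.grp C A ↔ ∃ X : NSeq n A C, ξ X δ

/-- `(𝓒, E_ξ, s_ξ)` is an `n`-exangulated category. In particular `E_ξ` is an additive
sub-bifunctor of `E`. -/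
def RestrictionIsNExangulated [HasBinaryBiproducts 𝓒] (s : Corr n E) (ξ : ExangleClass n E) :
    Prop :=
  ∃ F : AddSubBifunctor E, IsSubfunctorOf ξ F ∧ IsNExangulated n F.toBifunctor (F.restrict s)

end Proper

/-! ## `n`-exact categories -/

section NExact

variable {n : ℕ}

/-- `(d⁰, …, dⁿ⁻¹)` is an `n`-kernel of `dⁿ`. -/
structure LeftNExact {A C : 𝓒} (X : NSeq n A C) : Prop where
  mono : Mono X.inf
  exact : CovExact n X.K

/-- `(d¹, …, dⁿ)` is an `n`-cokernel of `d⁰`. -/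
structure RightNExact {A C : 𝓒} (X : NSeq n A C) : Prop where
  epi : Epi X.defl
  exact : ContraExact n X.K

/-- `X` is an `n`-exact sequence. -/
def IsNExactSeq {A C : 𝓒} (X : NSeq n A C) : Prop := LeftNExact X ∧ RightNExact X

/-- Weak isomorphisms of `n`-exact sequences in the sense of Jasso: two cyclically consecutive
components are isomorphisms. -/
def JassoWeakIso {A C A' C' : 𝓒} {X : NSeq n A C} {Y : NSeq n A' C'} (f : X.K ⟶ Y.K) : Prop :=
  (∃ k, k ≤ n ∧ IsIso (f.f k) ∧ IsIso (f.f (k + 1))) ∨ (IsIso (f.f (n + 1)) ∧ IsIso (f.f 0))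

/-- The class `𝒳` of admissible sequences makes `𝓒` an `n`-exact category (Jasso). -/
structure IsNExactStructure [HasBinaryBiproducts 𝓒] (𝒳 : SeqClass 𝓒 n) : Prop where
  nExact : ∀ {A C : 𝓒} (X : NSeq n A C), 𝒳 X → IsNExactSeq X
  weakIso : ∀ {A C A' C' : 𝓒} (X : NSeq n A C) (Y : NSeq n A' C'), IsNExactSeq X → IsNExactSeq Y →
    ∀ f : X.K ⟶ Y.K, JassoWeakIso (X := X) (Y := Y) f → (𝒳 X ↔ 𝒳 Y)
  /-- (E0) the zero sequence is admissible -/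
  zero : ∀ {A C : 𝓒} (X : NSeq n A C), (∀ i, IsZero (X.K.X i)) → 𝒳 X
  /-- (E1) -/
  mono_comp : ∀ {A B C : 𝓒} (f : A ⟶ B) (g : B ⟶ C),
    IsInflation 𝒳 f → IsInflation 𝒳 g → IsInflation 𝒳 (f ≫ g)
  epi_comp : ∀ {A B C : 𝓒} (f : A ⟶ B) (g : B ⟶ C),
    IsDeflation 𝒳 f → IsDeflation 𝒳 g → IsDeflation 𝒳 (f ≫ g)
  /-- (E2) there is an `n`-pushout `L⁰ ⟶ ⋯ ⟶ Lⁿ` of `X⁰ ⟶ ⋯ ⟶ Xⁿ` along `f` whose first morphism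
  is an admissible monomorphism. Only the degrees `0, …, n` of `L` enter. -/
  pushout : ∀ {A C : 𝓒} (X : NSeq n A C), 𝒳 X → ∀ (B : 𝓒) (f : A ⟶ B),
    ∃ (L : CochainComplex 𝓒 ℕ) (φ : X.K ⟶ L) (e : L.X 0 ≅ B) (N : MappingCocone n φ),
      φ.f 0 ≫ e.hom = X.α.hom ≫ f ∧ RightNExact N.seq ∧ IsInflation 𝒳 (e.inv ≫ L.d 0 1)
  /-- (E2), dual: there is an `n`-pullback `L¹ ⟶ ⋯ ⟶ Lⁿ⁺¹` of `X¹ ⟶ ⋯ ⟶ Xⁿ⁺¹` along `g` whose last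
  morphism is an admissible epimorphism. Only the degrees `1, …, n + 1` of `L` enter. -/
  pullback : ∀ {A C : 𝓒} (X : NSeq n A C), 𝒳 X → ∀ (B : 𝓒) (g : B ⟶ C),
    ∃ (L : CochainComplex 𝓒 ℕ) (φ : L ⟶ X.K) (e : L.X (n + 1) ≅ B) (M : MappingCone n φ),
      φ.f (n + 1) ≫ X.γ.hom = e.hom ≫ g ∧ LeftNExact M.seq ∧
        IsDeflation 𝒳 (L.d n (n + 1) ≫ e.hom)

/-- The `n`-exangulated category `(𝓒, E, s)` is an `n`-exact category: its conflations are the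
admissible sequences of an `n`-exact structure, and `E(C, A)` is, through `s`, the set of homotopy
classes of admissible sequences from `A` to `C`. (The bifunctor `E` is then determined by the
`n`-exact structure: `a_*` and `c^*` are given by `n`-pushouts and `n`-pullbacks because of (R0),
and the addition is the Baer sum because `E` is additive.) -/
structure IsNExact [HasBinaryBiproducts 𝓒] (n : ℕ) (E : 𝓒ᵒᵖ ⥤ 𝓒 ⥤ AddCommGrpCat.{w})
    (s : Corr n E) : Prop where
  exangulated : IsNExangulated n E s
  nExact : IsNExactStructure (Conf s)
  injective : ∀ A C : 𝓒, Function.Injective (fun δ : Ext E C A => s δ)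

/-- The class of distinguished `n`-exangles that is induced by a class of sequences. -/
def inducedClass {E : 𝓒ᵒᵖ ⥤ 𝓒 ⥤ AddCommGrpCat.{w}} (s : Corr n E) (ξ : SeqClass 𝓒 n) :
    ExangleClass n E :=
  fun _ _ X δ => s δ = ⟦X⟧ ∧ ξ X

/-- `(𝓒, E_ξ, s_ξ)` is an `n`-exact category. -/
def RestrictionIsNExact [HasBinaryBiproducts 𝓒] {E : 𝓒ᵒᵖ ⥤ 𝓒 ⥤ AddCommGrpCat.{w}}
    (s : Corr n E) (ξ : ExangleClass n E) : Prop :=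
  ∃ F : AddSubBifunctor E, IsSubfunctorOf ξ F ∧ IsNExact n F.toBifunctor (F.restrict s)

end NExact

/-! ## `(n + 2)`-angulated categories -/

/-- An `(n + 2)`-`Σ`-sequence `X⁰ ⟶ X¹ ⟶ ⋯ ⟶ Xⁿ⁺¹ ⟶ Σ X⁰`. -/
structure SigmaSeq (n : ℕ) (S : 𝓒 ⥤ 𝓒) where
  /-- the objects -/
  X : Fin (n + 2) → 𝓒
  /-- the morphisms `Xⁱ ⟶ Xⁱ⁺¹` -/
  d : ∀ i : Fin (n + 1), X i.castSucc ⟶ X i.succ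
  /-- the morphism `Xⁿ⁺¹ ⟶ Σ X⁰` -/
  w : X (Fin.last (n + 1)) ⟶ S.obj (X 0)

namespace SigmaSeq

variable {n : ℕ} {S : 𝓒 ⥤ 𝓒}

/-- Morphisms of `Σ`-sequences. -/
structure Hom (T T' : SigmaSeq n S) where
  /-- the components -/
  f : ∀ i : Fin (n + 2), T.X i ⟶ T'.X i
  comm : ∀ i : Fin (n + 1), T.d i ≫ f i.succ = f i.castSucc ≫ T'.d i
  comm_w : T.w ≫ S.map (f 0) = f (Fin.last (n + 1)) ≫ T'.w

/-- The direct sum of two `Σ`-sequences. -/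
noncomputable def sum [HasBinaryBiproducts 𝓒] (T T' : SigmaSeq n S) : SigmaSeq n S where
  X i := T.X i ⊞ T'.X i
  d i := biprod.map (T.d i) (T'.d i)
  w := biprod.desc (T.w ≫ S.map biprod.inl) (T'.w ≫ S.map biprod.inr)

/-- `R` is (isomorphic to) the left rotation
`X¹ ⟶ X² ⟶ ⋯ ⟶ Xⁿ⁺¹ ⟶ Σ X⁰ ⟶ Σ X¹` of `T`, with the last morphism `(-1)ⁿ Σ d⁰`. -/
structure LeftRotation (T R : SigmaSeq n S) where
  /-- the terms in the degrees `0, …, n` -/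
  e : ∀ i : Fin (n + 1), R.X i.castSucc ≅ T.X i.succ
  /-- the term in the degree `n + 1` -/
  eLast : R.X (Fin.last (n + 1)) ≅ S.obj (T.X 0)
  comm : ∀ i : Fin n, R.d i.castSucc ≫ (e i.succ).hom = (e i.castSucc).hom ≫ T.d i.succ
  comm_last : R.d (Fin.last n) ≫ eLast.hom = (e (Fin.last n)).hom ≫ T.w
  comm_w : R.w ≫ S.map (e 0).hom = eLast.hom ≫ ((-1 : ℤ) ^ n • S.map (T.d 0))

/-- `M` is (isomorphic to) the mapping cone
`X¹ ⊕ Y⁰ ⟶ X² ⊕ Y¹ ⟶ ⋯ ⟶ Σ X⁰ ⊕ Yⁿ⁺¹ ⟶ Σ X¹ ⊕ Σ Y⁰`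
of `φ`, with the differentials `(-d 0 ; φ d)`. -/
structure Cone [HasBinaryBiproducts 𝓒] {T T' : SigmaSeq n S} (φ : Hom T T')
    (M : SigmaSeq n S) where
  /-- the terms in the degrees `0, …, n` -/
  e : ∀ i : Fin (n + 1), M.X i.castSucc ≅ T.X i.succ ⊞ T'.X i.castSucc
  /-- the term in the degree `n + 1` -/
  eLast : M.X (Fin.last (n + 1)) ≅ S.obj (T.X 0) ⊞ T'.X (Fin.last (n + 1))
  comm : ∀ i : Fin n, M.d i.castSucc ≫ (e i.succ).hom =
    (e i.castSucc).hom ≫ biprod.desc (biprod.lift (-T.d i.succ) (φ.f i.succ.castSucc))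
      (biprod.lift 0 (T'.d i.castSucc))
  comm_last : M.d (Fin.last n) ≫ eLast.hom =
    (e (Fin.last n)).hom ≫ biprod.desc (biprod.lift (-T.w) (φ.f (Fin.last (n + 1))))
      (biprod.lift 0 (T'.d (Fin.last n)))
  comm_w_fst : M.w ≫ S.map ((e 0).hom ≫ biprod.fst) = eLast.hom ≫ biprod.fst ≫ (-S.map (T.d 0))
  comm_w_snd : M.w ≫ S.map ((e 0).hom ≫ biprod.snd) =
    eLast.hom ≫ biprod.desc (S.map (φ.f 0)) T'.w

end SigmaSeq

/-- The class `Θ` makes `(𝓒, Σ)` an `(n + 2)`-angulated category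
(Geiss, Keller and Oppermann). -/
structure IsAngulated [HasBinaryBiproducts 𝓒] (n : ℕ) (S : 𝓒 ⥤ 𝓒) (Θ : SigmaSeq n S → Prop) :
    Prop where
  iso_mem : ∀ (T T' : SigmaSeq n S) (φ : SigmaSeq.Hom T T'), (∀ i, IsIso (φ.f i)) → Θ T → Θ T'
  /-- (F1) (a) closure under direct sums and direct summands -/
  sum_mem : ∀ T T' : SigmaSeq n S, Θ T → Θ T' → Θ (T.sum T')
  summand_mem : ∀ T T' : SigmaSeq n S, Θ (T.sum T') → Θ T
  /-- (F1) (b) the trivial sequences `X = X ⟶ 0 ⟶ ⋯ ⟶ 0 ⟶ Σ X` -/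
  trivial_mem : ∀ T : SigmaSeq n S, IsIso (T.d 0) → (∀ i : Fin n, IsZero (T.X i.succ.succ)) → Θ T
  /-- (F1) (c) each morphism is the first morphism of an `(n + 2)`-angle -/
  exists_angle : ∀ {A B : 𝓒} (f : A ⟶ B), ∃ T : SigmaSeq n S, Θ T ∧
    ∃ (e₀ : T.X (Fin.castSucc 0) ≅ A) (e₁ : T.X (Fin.succ 0) ≅ B), T.d 0 ≫ e₁.hom = e₀.hom ≫ f
  /-- (F2) -/
  rotate : ∀ T R : SigmaSeq n S, Nonempty (SigmaSeq.LeftRotation T R) → (Θ T ↔ Θ R)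
  /-- (F3) and (F4): a commutative square on the first two terms can be completed to a morphism
  whose mapping cone is an `(n + 2)`-angle -/
  complete : ∀ T T' : SigmaSeq n S, Θ T → Θ T' →
    ∀ (a : T.X (Fin.castSucc 0) ⟶ T'.X (Fin.castSucc 0)) (b : T.X (Fin.succ 0) ⟶ T'.X (Fin.succ 0)),
    T.d 0 ≫ b = a ≫ T'.d 0 →
    ∃ φ : SigmaSeq.Hom T T', φ.f (Fin.castSucc 0) = a ∧ φ.f (Fin.succ 0) = b ∧
      ∃ M : SigmaSeq n S, Nonempty (SigmaSeq.Cone φ M) ∧ Θ M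

/-- The `Σ`-sequence `A ⟶ X¹ ⟶ ⋯ ⟶ Xⁿ ⟶ C ⟶ Σ A` given by a sequence and a morphism
`C ⟶ Σ A`. -/
def NSeq.toSigma {n : ℕ} {S : 𝓒 ⥤ 𝓒} {A C : 𝓒} (X : NSeq n A C) (δ : C ⟶ S.obj A) :
    SigmaSeq n S where
  X i := X.K.X i.val
  d i := X.K.d i.val (i.val + 1)
  w := X.γ.hom ≫ δ ≫ S.map X.α.inv

/-- A presentation of `(𝓒, E, s)` as an `(n + 2)`-angulated category: an autoequivalence `Σ` and a
class `Θ` of `(n + 2)`-angles, together with a natural isomorphism `E(C, A) ≅ 𝓒(C, Σ A)` under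
which the distinguished `n`-exangles are the `(n + 2)`-angles. -/
structure AngulatedPresentation [HasBinaryBiproducts 𝓒] (n : ℕ)
    (E : 𝓒ᵒᵖ ⥤ 𝓒 ⥤ AddCommGrpCat.{w}) (s : Corr n E) where
  /-- the suspension -/
  S : 𝓒 ⥤ 𝓒
  isEquivalence : S.IsEquivalence
  additive : S.Additive
  /-- the class of `(n + 2)`-angles -/
  Θ : SigmaSeq n S → Prop
  isAngulated : IsAngulated n S Θ
  /-- the isomorphism `E(C, A) ≅ 𝓒(C, Σ A)` -/
  φ : ∀ C A : 𝓒, Ext E C A ≃+ (C ⟶ S.obj A)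
  φ_push : ∀ {C A A' : 𝓒} (a : A ⟶ A') (δ : Ext E C A), φ C A' (push E a δ) = φ C A δ ≫ S.map a
  φ_pull : ∀ {C C' A : 𝓒} (c : C' ⟶ C) (δ : Ext E C A), φ C' A (pull E c δ) = c ≫ φ C A δ
  distinguished_iff : ∀ {A C : 𝓒} (X : NSeq n A C) (δ : Ext E C A),
    s δ = ⟦X⟧ ↔ Θ (X.toSigma (φ C A δ))

/-- The class of distinguished `n`-exangles that is induced by a class of `(n + 2)`-angles. -/
def AngulatedPresentation.inducedClass [HasBinaryBiproducts 𝓒] {n : ℕ}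
    {E : 𝓒ᵒᵖ ⥤ 𝓒 ⥤ AddCommGrpCat.{w}} {s : Corr n E} (P : AngulatedPresentation n E s)
    (ξ : SigmaSeq n P.S → Prop) : ExangleClass n E :=
  fun _ C X δ => s δ = ⟦X⟧ ∧ ξ (X.toSigma (P.φ C _ δ))

end NExang

/-! Both parts rest on one equivalence, `isNProper_iff_restriction`: a class `ξ` closed under weak
isomorphisms is `n`-proper exactly when `E_ξ` carries an `n`-exangulated structure. Closure under
weak isomorphisms makes membership in `ξ` depend on the extension alone, so one may work with a
subfunctor `F` of `E`.

The tools are two exact sequences. For `⟨X, δ⟩` distinguished, an extension killed by `dⁿ` is a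
pushout of `δ` (`exists_push_eq`), and one killed by `d⁰` is a pullback of `δ` (`exists_pull_eq`).
Hence an extension killed by an `F`-deflation or by an `F`-inflation lies in `F`.

If `ξ` is `n`-proper, Baer sums make `E_ξ` an additive subfunctor, and saturation with an identity
on one side of the square says that `ξ`-deflations compose. Composition of `ξ`-inflations follows
from the exact sequences (`isInflation_comp_restrict`); the remaining axioms are inherited, since
the extensions realized by cones and cocones are pushouts and pullbacks of given ones. Conversely,
in a square `ba = dc` the extension of `d` is killed by `d`, hence by the `ξ`-deflation `ba`, hence
lies in `E_ξ`; and direct sums of distinguished `n`-exangles are distinguished (`realize_sum`).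

For part (1) it remains to see that an `n`-exangulated substructure of an `n`-exact category is
`n`-exact. The delicate point is Jasso's weak isomorphisms, whose invertible components may lie in
the middle: `mem_iff_mem_of_jassoWeakIso` shows that each extension is recovered from the other by
pushing and pulling. -/

namespace NExang

/-! ### Calculus of extensions and the two exact sequences -/

section Extensions

variable {𝓒 : Type u} [Category.{v} 𝓒] {E : 𝓒ᵒᵖ ⥤ 𝓒 ⥤ AddCommGrpCat.{w}}

@[simp]
theorem push_id {A C : 𝓒} (δ : Ext E C A) : push E (𝟙 A) δ = δ := by simp [push]

@[simp]
theorem pull_id {A C : 𝓒} (δ : Ext E C A) : pull E (𝟙 C) δ = δ := by simp [pull]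

theorem push_comp {A A' A'' C : 𝓒} (a : A ⟶ A') (b : A' ⟶ A'') (δ : Ext E C A) :
    push E (a ≫ b) δ = push E b (push E a δ) := by simp [push]

theorem pull_comp {A C C' C'' : 𝓒} (c : C'' ⟶ C') (d : C' ⟶ C) (δ : Ext E C A) :
    pull E (c ≫ d) δ = pull E c (pull E d δ) := by simp [pull]

@[simp]
theorem push_map_zero {A A' C : 𝓒} (a : A ⟶ A') : push E a (0 : Ext E C A) = 0 :=
  map_zero ((E.obj (op C)).map a).hom

@[simp]
theorem pull_map_zero {A C C' : 𝓒} (c : C' ⟶ C) : pull E c (0 : Ext E C A) = 0 :=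
  map_zero ((E.map c.op).app A).hom

@[simp]
theorem push_map_add {A A' C : 𝓒} (a : A ⟶ A') (δ δ' : Ext E C A) :
    push E a (δ + δ') = push E a δ + push E a δ' :=
  map_add ((E.obj (op C)).map a).hom δ δ'

@[simp]
theorem pull_map_add {A C C' : 𝓒} (c : C' ⟶ C) (δ δ' : Ext E C A) :
    pull E c (δ + δ') = pull E c δ + pull E c δ' :=
  map_add ((E.map c.op).app A).hom δ δ'

theorem push_pull {A A' C C' : 𝓒} (a : A ⟶ A') (c : C' ⟶ C) (δ : Ext E C A) :
    push E a (pull E c δ) = pull E c (push E a δ) :=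
  (NatTrans.naturality_apply (E.map c.op) a δ).symm

variable [Preadditive 𝓒]

theorem add_push {C : 𝓒} [(E.obj (op C)).Additive] {A A' : 𝓒} (a b : A ⟶ A') (δ : Ext E C A) :
    push E (a + b) δ = push E a δ + push E b δ := by
  simp [push, Functor.map_add]

theorem add_pull [E.Additive] {A C C' : 𝓒} (c d : C' ⟶ C) (δ : Ext E C A) :
    pull E (c + d) δ = pull E c δ + pull E d δ := by
  simp [pull, Functor.map_add]

theorem zero_push {C : 𝓒} [(E.obj (op C)).Additive] {A A' : 𝓒} (δ : Ext E C A) :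
    push E (0 : A ⟶ A') δ = 0 := by
  simp [push]

theorem zero_pull [E.Additive] {A C C' : 𝓒} (δ : Ext E C A) :
    pull E (0 : C' ⟶ C) δ = 0 := by
  simp [pull]

theorem IsExangle.push_inf {n : ℕ} {A C : 𝓒} {X : NSeq n A C} {δ : Ext E C A}
    (h : IsExangle E X δ) : push E X.inf δ = 0 :=
  (h.contra_last _ _).2 ⟨𝟙 _, Category.comp_id _⟩

theorem IsExangle.pull_defl {n : ℕ} {A C : 𝓒} {X : NSeq n A C} {δ : Ext E C A}
    (h : IsExangle E X δ) : pull E X.defl δ = 0 :=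
  (h.cov_last _ _).2 ⟨𝟙 _, Category.id_comp _⟩

variable [HasBinaryBiproducts 𝓒] {n : ℕ} {s : Corr n E}

/-- Exactness of `𝓒(A, B) ⟶ E(C, B) ⟶ E(Xⁿ, B)`. -/
theorem IsNExangulated.exists_push_eq (h : IsNExangulated n E s) (hn : 1 ≤ n) {A B C : 𝓒}
    {δ : Ext E C A} {X : NSeq n A C} (hX : s δ = ⟦X⟧) (ρ : Ext E C B)
    (hρ : pull E X.defl ρ = 0) : ∃ a : A ⟶ B, push E a δ = ρ := by
  have := h.additive_right
  -- The pair `(δ, ρ)` as one extension by `A ⊞ B`. The cocone of a good lift of `fst` realizes the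
  -- pullback of `θ` along `dⁿ`, up to the isomorphism at the end. That pullback is zero, so the
  -- inflation `(d⁰ ; f⁰)` of the cocone has a retraction `k`.
  let θ : Ext E C (A ⊞ B) := push E biprod.inl δ + push E biprod.inr ρ
  have hfst : push E biprod.fst θ = δ := by simp [θ, ← push_comp, zero_push]
  have hsnd : push E biprod.snd θ = ρ := by simp [θ, ← push_comp, zero_push]
  obtain ⟨Z, hZ⟩ := Quotient.exists_rep (s θ)
  obtain ⟨f, hf, N, hN⟩ := h.good_lift_op θ biprod.fst Z X hZ.symm (by rw [hfst, hX])
  have hθ : pull E X.defl θ = 0 := by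
    simp only [θ, pull_map_add, ← push_pull, (h.exangle δ X hX).pull_defl, hρ, push_map_zero,
      add_zero]
  obtain ⟨k, hk⟩ := ((h.exangle _ _ hN).contra_last _ (𝟙 _)).1 (by simp [hθ])
  let u : Z.K.X 1 ⟶ Z.K.X 0 := biprod.inl ≫ (N.e 0 1 rfl hn).inv ≫ k
  let v : X.K.X 0 ⟶ Z.K.X 0 := biprod.inr ≫ (N.e 0 1 rfl hn).inv ≫ k
  have huv : Z.K.d 0 1 ≫ u + f.f 0 ≫ v = 𝟙 _ := by
    have h1 : N.seq.inf = biprod.lift (Z.K.d 0 1) (f.f 0) ≫ (N.e 0 1 rfl hn).inv := by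
      rw [← N.inf_comm hn]; simp
    rw [← hk, h1, biprod.lift_eq]
    simp [u, v]
  have hl : Z.α.inv ≫ f.f 0 = biprod.fst ≫ X.α.inv := by
    rw [Iso.inv_comp_eq, ← Category.assoc, ← hf.left]; simp
  -- The identity of `A ⊞ B` is a map through `Z.inf`, which kills `θ`, plus a map through `fst`.
  -- Hence `θ` is a pushout of `fst_* θ = δ`, and so is `ρ = snd_* θ`.
  have hid : Z.inf ≫ u ≫ Z.α.hom + biprod.fst ≫ X.α.inv ≫ v ≫ Z.α.hom = 𝟙 (A ⊞ B) := by
    have := congrArg (fun t => Z.α.inv ≫ t ≫ Z.α.hom) huv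
    simp only [Preadditive.add_comp, Preadditive.comp_add, Category.assoc, Category.id_comp,
      Iso.inv_hom_id, reassoc_of% hl] at this
    rw [← this, NSeq.inf, Category.assoc]
  refine ⟨(X.α.inv ≫ v ≫ Z.α.hom) ≫ biprod.snd, ?_⟩
  rw [push_comp, ← hsnd]
  congr 1
  rw [← push_id θ, ← hid, add_push, push_comp _ _ θ, push_comp _ _ θ, hfst,
    (h.exangle θ Z hZ.symm).push_inf, push_map_zero, zero_add]

/-- Exactness of `𝓒(W, C) ⟶ E(W, A) ⟶ E(W, X¹)`. -/
theorem IsNExangulated.exists_pull_eq (h : IsNExangulated n E s) (hn : 1 ≤ n) {A C W : 𝓒}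
    {δ : Ext E C A} {X : NSeq n A C} (hX : s δ = ⟦X⟧) (τ : Ext E W A)
    (hτ : push E X.inf τ = 0) : ∃ c : W ⟶ C, pull E c δ = τ := by
  have := h.additive_left
  -- The dual device: the cone of a good lift of `inl` realizes a zero extension, so its deflation
  -- `(f d)` has a section.
  let θ : Ext E (C ⊞ W) A := pull E biprod.fst δ + pull E biprod.snd τ
  have hinl : pull E biprod.inl θ = δ := by simp [θ, ← pull_comp, zero_pull]
  have hinr : pull E biprod.inr θ = τ := by simp [θ, ← pull_comp, zero_pull]
  obtain ⟨Z, hZ⟩ := Quotient.exists_rep (s θ)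
  obtain ⟨f, hf, M, hM⟩ := h.good_lift θ biprod.inl X Z (by rw [hinl, hX]) hZ.symm
  have hθ : push E X.inf θ = 0 := by
    simp only [θ, push_map_add, push_pull, (h.exangle δ X hX).push_inf, hτ, pull_map_zero,
      add_zero]
  obtain ⟨k, hk⟩ := ((h.exangle _ _ hM).cov_last _ (𝟙 _)).1 (by simp [push_pull, hθ])
  let u : Z.K.X (n + 1) ⟶ Z.K.X n := k ≫ (M.e n hn le_rfl).hom ≫ biprod.snd
  let v : Z.K.X (n + 1) ⟶ X.K.X (n + 1) := k ≫ (M.e n hn le_rfl).hom ≫ biprod.fst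
  have huv : u ≫ Z.K.d n (n + 1) + v ≫ f.f (n + 1) = 𝟙 _ := by
    rw [← hk, M.defl_comm hn, biprod.desc_eq]
    simp [u, v, add_comm]
  have hid : (Z.γ.inv ≫ u) ≫ Z.defl + (Z.γ.inv ≫ v ≫ X.γ.hom) ≫ biprod.inl = 𝟙 (C ⊞ W) := by
    have := congrArg (fun t => Z.γ.inv ≫ t ≫ Z.γ.hom) huv
    simp only [Preadditive.add_comp, Preadditive.comp_add, Category.assoc, Category.id_comp,
      Iso.inv_hom_id, hf.right] at this
    simpa only [NSeq.defl, Category.assoc] using this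
  refine ⟨biprod.inr ≫ Z.γ.inv ≫ v ≫ X.γ.hom, ?_⟩
  rw [pull_comp, ← hinr]
  congr 1
  rw [← pull_id θ, ← hid, add_pull, pull_comp _ _ θ, pull_comp _ _ θ, hinl,
    (h.exangle θ Z hZ.symm).pull_defl, pull_map_zero, zero_add]

end Extensions

/-! ### Uniqueness of realizations up to homotopy, and direct sums -/

section Homotopy

variable {𝓒 : Type u} [Category.{v} 𝓒] [Preadditive 𝓒] {n : ℕ}

/-- An endomorphism of a contravariantly exact complex that vanishes in degree `0` is homotopic to
one that is concentrated in degree `n + 1`, whence its square is null-homotopic. -/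
theorem exists_homotopy_sq_zero {A C : 𝓒} (X : NSeq n A C) (hX : ContraExact n X.K)
    (u : X.K ⟶ X.K) (h0 : u.f 0 = 0) (hlast : u.f (n + 1) = 0) : Nonempty (Homotopy (u ≫ u) 0) := by
  -- The conditions on `k` are moved behind the existential, with `0` as the default value, so that
  -- the contraction can be defined by plain recursion on all degrees.
  have step : ∀ (i : ℕ) (k : X.K.X (i + 1) ⟶ X.K.X i), ∃ k' : X.K.X (i + 2) ⟶ X.K.X (i + 1),
      i < n → X.K.d i (i + 1) ≫ (u.f (i + 1) - k ≫ X.K.d i (i + 1)) = 0 →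
        u.f (i + 1) = X.K.d (i + 1) (i + 2) ≫ k' + k ≫ X.K.d i (i + 1) := by
    intro i k
    by_cases hi : i < n ∧ X.K.d i (i + 1) ≫ (u.f (i + 1) - k ≫ X.K.d i (i + 1)) = 0
    · obtain ⟨k', hk'⟩ := hX _ i hi.1 _ hi.2
      exact ⟨k', fun _ _ => by rw [hk']; simp⟩
    · exact ⟨0, fun h1 h2 => (hi ⟨h1, h2⟩).elim⟩
  choose nxt hnxt using step
  let H : ∀ i : ℕ, X.K.X (i + 1) ⟶ X.K.X i := fun i => Nat.rec 0 (fun i k => nxt i k) i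
  have H0 : H 0 = 0 := rfl
  have Hs : ∀ i, H (i + 1) = nxt i (H i) := fun i => rfl
  have key : ∀ i, i ≤ n → X.K.d i (i + 1) ≫ (u.f (i + 1) - H i ≫ X.K.d i (i + 1)) = 0 := by
    intro i
    induction i with
    | zero => intro _; simp [H0, ← u.comm, h0]
    | succ i ih =>
      intro hi
      have e := hnxt i (H i) (by omega) (ih (by omega))
      rw [← Hs] at e
      rw [Preadditive.comp_sub, ← u.comm, e]
      simp
  let N : X.K ⟶ X.K := Homotopy.nullHomotopicMap' fun i j hij => by
    obtain rfl : j + 1 = i := hij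
    exact H j
  have hN0 : N.f 0 = X.K.d 0 1 ≫ H 0 := by
    rw [Homotopy.nullHomotopicMap'_f_of_not_rel_right (k₀ := 1) rfl (by simp)]
  have hNs : ∀ i, N.f (i + 1) = X.K.d (i + 1) (i + 2) ≫ H (i + 1) + H i ≫ X.K.d i (i + 1) := by
    intro i
    rw [Homotopy.nullHomotopicMap'_f (k₂ := i) (k₁ := i + 1) (k₀ := i + 2) rfl rfl]
  have hN : Homotopy N 0 := Homotopy.nullHomotopy' _
  let w : X.K ⟶ X.K := u - N
  have hw : ∀ i, i ≤ n → w.f i = 0 := by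
    intro i hi
    cases i with
    | zero => simp [w, hN0, H0, h0]
    | succ i =>
      have e := hnxt i (H i) (by omega) (key i (by omega))
      rw [← Hs] at e
      simp [w, hNs, e]
  have hwl : w.f (n + 1) = -(H n ≫ X.K.d n (n + 1)) := by
    have : X.K.d (n + 1) (n + 2) = 0 := (X.isZero (n + 2) (by omega)).eq_of_tgt _ _
    simp [w, hNs, hlast, this]
  have hww : w ≫ w = 0 := by
    ext i
    rcases lt_trichotomy i (n + 1) with hi | rfl | hi
    · simp [hw i (by omega)]
    · simp only [HomologicalComplex.comp_f, HomologicalComplex.zero_f]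
      -- In degree `n + 1` the square is `-(H n ≫ d ≫ w)`, and `d ≫ w` equals `w.f n ≫ d`, which is
      -- zero.
      nth_rw 1 [hwl]
      rw [Preadditive.neg_comp, Category.assoc, ← w.comm, hw n le_rfl]
      simp
    · exact (X.isZero i hi).eq_of_src _ _
  have huw : Homotopy u w := Homotopy.equivSubZero.symm
    ((Homotopy.ofEq (by simp [w])).trans hN)
  exact ⟨(huw.comp huw).trans (Homotopy.ofEq hww)⟩

theorem NSeq.Lifts.f_zero {A C : 𝓒} {X : NSeq n A C} {u : X.K ⟶ X.K}
    (h : NSeq.Lifts (X := X) (Y := X) u (𝟙 A) (𝟙 C)) : u.f 0 = 𝟙 _ := by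
  simpa [← cancel_mono X.α.hom] using h.left

theorem NSeq.Lifts.f_last {A C : 𝓒} {X : NSeq n A C} {u : X.K ⟶ X.K}
    (h : NSeq.Lifts (X := X) (Y := X) u (𝟙 A) (𝟙 C)) : u.f (n + 1) = 𝟙 _ := by
  simpa [← cancel_mono X.γ.hom] using h.right

/-- Since `1 - u(2 - u) = (u - 1)²` and `u - 1` vanishes at both ends, the preceding result applies:
`u` is invertible up to homotopy, with inverse `2 - u`. -/
theorem NSeq.Lifts.exists_homotopy_sub_sq {A C : 𝓒} {X : NSeq n A C} (hX : ContraExact n X.K)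
    {u : X.K ⟶ X.K} (h : NSeq.Lifts (X := X) (Y := X) u (𝟙 A) (𝟙 C)) :
    Nonempty (Homotopy (u ≫ (𝟙 _ + 𝟙 _ - u)) (𝟙 X.K)) := by
  obtain ⟨H⟩ := exists_homotopy_sq_zero X hX (u - 𝟙 _) (by simp [h.f_zero]) (by simp [h.f_last])
  refine ⟨(Homotopy.equivSubZero.symm ((Homotopy.ofEq ?_).trans H)).symm⟩
  simp only [Preadditive.comp_sub, Preadditive.sub_comp, Preadditive.comp_add, Category.comp_id,
    Category.id_comp]
  abel

/-- Two contravariantly exact sequences are homotopy equivalent as soon as there are morphisms with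
identity ends in both directions. -/
theorem NSeq.htpyEquiv_of_lifts {A C : 𝓒} {X Y : NSeq n A C} (hX : ContraExact n X.K)
    (hY : ContraExact n Y.K) {f : X.K ⟶ Y.K} {g : Y.K ⟶ X.K}
    (hf : NSeq.Lifts (X := X) (Y := Y) f (𝟙 A) (𝟙 C))
    (hg : NSeq.Lifts (X := Y) (Y := X) g (𝟙 A) (𝟙 C)) : NSeq.HtpyEquiv X Y := by
  have hfg := hf.comp hg
  have hgf := hg.comp hf
  obtain ⟨H₁⟩ := hfg.exists_homotopy_sub_sq hX
  obtain ⟨H₂⟩ := hgf.exists_homotopy_sub_sq hY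
  have hc : NSeq.Lifts (X := X) (Y := X) (𝟙 _ + 𝟙 _ - f ≫ g) (𝟙 A) (𝟙 C) :=
    ⟨by simp [hfg.f_zero, -HomologicalComplex.comp_f],
      by simp [hfg.f_last, -HomologicalComplex.comp_f]⟩
  -- The corrected inverse `g ≫ (2 - f ≫ g)` serves on both sides, because `g ≫ (2 - f ≫ g) ≫ f = (g
  -- ≫ f) ≫ (2 - g ≫ f)`.
  refine ⟨⟨f, g ≫ (𝟙 _ + 𝟙 _ - f ≫ g), (Homotopy.ofEq ?_).trans H₁,
    (Homotopy.ofEq ?_).trans H₂⟩, hf, hg.comp hc⟩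
  · simp
  · simp [Preadditive.comp_sub, Preadditive.sub_comp, Preadditive.comp_add, Preadditive.add_comp]

variable [HasBinaryBiproducts 𝓒]

theorem ContraExact.biprod {K L : CochainComplex 𝓒 ℕ} (hK : ContraExact n K)
    (hL : ContraExact n L) : ContraExact n (K ⊞ L) := by
  intro W i hi g hg
  obtain ⟨k, hk⟩ := hK W i hi ((biprod.inl : K ⟶ K ⊞ L).f (i + 1) ≫ g)
    (by rw [← HomologicalComplex.Hom.comm_assoc, hg, comp_zero])
  obtain ⟨l, hl⟩ := hL W i hi ((biprod.inr : L ⟶ K ⊞ L).f (i + 1) ≫ g)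
    (by rw [← HomologicalComplex.Hom.comm_assoc, hg, comp_zero])
  refine ⟨(biprod.fst : K ⊞ L ⟶ K).f (i + 2) ≫ k + (biprod.snd : K ⊞ L ⟶ L).f (i + 2) ≫ l, ?_⟩
  rw [Preadditive.comp_add, ← HomologicalComplex.Hom.comm_assoc,
    ← HomologicalComplex.Hom.comm_assoc, hk, hl, ← Category.assoc, ← Category.assoc,
    ← Preadditive.add_comp, HomologicalComplex.biprod_total_f, Category.id_comp]

variable {E : 𝓒ᵒᵖ ⥤ 𝓒 ⥤ AddCommGrpCat.{w}} {s : Corr n E}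

/-- The direct sum of two distinguished `n`-exangles is distinguished. -/
theorem IsNExangulated.realize_sum (h : IsNExangulated n E s) {A C A' C' : 𝓒} {X : NSeq n A C}
    {δ : Ext E C A} {Y : NSeq n A' C'} {ρ : Ext E C' A'} (hX : s δ = ⟦X⟧) (hY : s ρ = ⟦Y⟧) :
    s (extSum E δ ρ) = ⟦X.sum Y⟧ := by
  have := h.additive_left
  have := h.additive_right
  obtain ⟨Z, hZ⟩ := Quotient.exists_rep (s (extSum E δ ρ))
  -- Lifts of the four structure maps of the biproducts assemble into morphisms in both directions
  -- between a realization `Z` and `X ⊞ Y`, with identity ends. This suffices for a homotopy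
  -- equivalence.
  obtain ⟨f₁, hf₁⟩ := h.exists_lift δ (extSum E δ ρ) X Z hX hZ.symm biprod.inl biprod.inl
    (by simp [extSum, ← pull_comp, zero_pull])
  obtain ⟨f₂, hf₂⟩ := h.exists_lift ρ (extSum E δ ρ) Y Z hY hZ.symm biprod.inr biprod.inr
    (by simp [extSum, ← pull_comp, zero_pull])
  obtain ⟨g₁, hg₁⟩ := h.exists_lift (extSum E δ ρ) δ Z X hZ.symm hX biprod.fst biprod.fst
    (by simp [extSum, ← push_comp, zero_push, push_pull])
  obtain ⟨g₂, hg₂⟩ := h.exists_lift (extSum E δ ρ) ρ Z Y hZ.symm hY biprod.snd biprod.snd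
    (by simp [extSum, ← push_comp, zero_push, push_pull])
  rw [← hZ]
  refine Quotient.sound (NSeq.htpyEquiv_of_lifts (f := biprod.lift g₁ g₂) (g := biprod.desc f₁ f₂)
    (h.exangle _ Z hZ.symm).contra
    ((h.exangle _ X hX).contra.biprod (h.exangle _ Y hY).contra) ⟨?_, ?_⟩ ⟨?_, ?_⟩)
  · apply biprod.hom_ext
    · simp [NSeq.sum, hg₁.left]
    · simp [NSeq.sum, hg₂.left]
  · apply biprod.hom_ext
    · simp [NSeq.sum, hg₁.right]
    · simp [NSeq.sum, hg₂.right]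
  · change (biprod.desc f₁ f₂ : X.K ⊞ Y.K ⟶ Z.K).f 0 ≫ Z.α.hom =
      ((HomologicalComplex.biprodXIso X.K Y.K 0).hom ≫ biprod.map X.α.hom Y.α.hom) ≫ 𝟙 _
    apply HomologicalComplex.biprodX_ext_from
    · rw [HomologicalComplex.biprod_inl_desc_f_assoc, hf₁.left,
        ← HomologicalComplex.inl_biprodXIso_inv]
      simp [-HomologicalComplex.inl_biprodXIso_inv]
    · rw [HomologicalComplex.biprod_inr_desc_f_assoc, hf₂.left,
        ← HomologicalComplex.inr_biprodXIso_inv]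
      simp [-HomologicalComplex.inr_biprodXIso_inv]
  · change (biprod.desc f₁ f₂ : X.K ⊞ Y.K ⟶ Z.K).f (n + 1) ≫ Z.γ.hom =
      ((HomologicalComplex.biprodXIso X.K Y.K (n + 1)).hom ≫ biprod.map X.γ.hom Y.γ.hom) ≫ 𝟙 _
    apply HomologicalComplex.biprodX_ext_from
    · rw [HomologicalComplex.biprod_inl_desc_f_assoc, hf₁.right,
        ← HomologicalComplex.inl_biprodXIso_inv]
      simp [-HomologicalComplex.inl_biprodXIso_inv]
    · rw [HomologicalComplex.biprod_inr_desc_f_assoc, hf₂.right,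
        ← HomologicalComplex.inr_biprodXIso_inv]
      simp [-HomologicalComplex.inr_biprodXIso_inv]

end Homotopy

/-! ### Restriction to an additive subfunctor -/

section Restriction

variable {𝓒 : Type u} [Category.{v} 𝓒] [Preadditive 𝓒] {n : ℕ}
  {E : 𝓒ᵒᵖ ⥤ 𝓒 ⥤ AddCommGrpCat.{w}} {s : Corr n E}

namespace AddSubBifunctor

variable (F : AddSubBifunctor E)

theorem conf_restrict_iff {A C : 𝓒} (X : NSeq n A C) :
    Conf (F.restrict s) X ↔ ∃ δ ∈ F.grp C A, s δ = ⟦X⟧ :=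
  ⟨fun ⟨δ, hδ⟩ => ⟨δ.1, δ.2, hδ⟩, fun ⟨δ, hδ, h⟩ => ⟨⟨δ, hδ⟩, h⟩⟩

theorem conf_of_restrict {A C : 𝓒} {X : NSeq n A C} (h : Conf (F.restrict s) X) : Conf s X :=
  let ⟨δ, hδ⟩ := h
  ⟨δ.1, hδ⟩

theorem isInflation_of_restrict {A B : 𝓒} {f : A ⟶ B}
    (h : IsInflation (Conf (F.restrict s)) f) : IsInflation (Conf s) f :=
  let ⟨C, X, e, hX, he⟩ := h
  ⟨C, X, e, F.conf_of_restrict hX, he⟩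

theorem isDeflation_of_restrict {B C : 𝓒} {g : B ⟶ C}
    (h : IsDeflation (Conf (F.restrict s)) g) : IsDeflation (Conf s) g :=
  let ⟨A, X, e, hX, he⟩ := h
  ⟨A, X, e, F.conf_of_restrict hX, he⟩

end AddSubBifunctor

theorem NSeq.isInflation_inf {𝒳 : SeqClass 𝓒 n} {A C : 𝓒} (X : NSeq n A C) (hX : 𝒳 X) :
    IsInflation 𝒳 X.inf :=
  ⟨C, X, Iso.refl _, hX, Category.comp_id _⟩

theorem NSeq.isDeflation_defl {𝒳 : SeqClass 𝓒 n} {A C : 𝓒} (X : NSeq n A C) (hX : 𝒳 X) :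
    IsDeflation 𝒳 X.defl :=
  ⟨A, X, Iso.refl _, hX, Category.id_comp _⟩

variable [HasBinaryBiproducts 𝓒] {F : AddSubBifunctor E}

/-- By exactness `τ` is a pushout of the extension in `F` that belongs to `g`. -/
theorem IsNExangulated.mem_of_pull_eq_zero (h : IsNExangulated n E s) (hn : 1 ≤ n) {A B C : 𝓒}
    {g : B ⟶ C} (hg : IsDeflation (Conf (F.restrict s)) g) (τ : Ext E C A)
    (hτ : pull E g τ = 0) : τ ∈ F.grp C A := by
  obtain ⟨A', X, e, ⟨δ, hδ⟩, rfl⟩ := hg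
  obtain ⟨a, rfl⟩ := h.exists_push_eq hn (δ := δ.1) (X := X) hδ τ (by
    have := congrArg (pull E e.hom) hτ
    rwa [← pull_comp, Iso.hom_inv_id_assoc, pull_map_zero] at this)
  exact F.push_mem a _ δ.2

theorem IsNExangulated.mem_of_push_eq_zero (h : IsNExangulated n E s) (hn : 1 ≤ n) {A B W : 𝓒}
    {f : A ⟶ B} (hf : IsInflation (Conf (F.restrict s)) f) (τ : Ext E W A)
    (hτ : push E f τ = 0) : τ ∈ F.grp W A := by
  obtain ⟨C, X, e, ⟨δ, hδ⟩, rfl⟩ := hf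
  obtain ⟨c, rfl⟩ := h.exists_pull_eq hn (δ := δ.1) (X := X) hδ τ (by
    have := congrArg (push E e.inv) hτ
    rwa [← push_comp, Category.assoc, Iso.hom_inv_id, Category.comp_id, push_map_zero] at this)
  exact F.pull_mem c _ δ.2

/-- The deflation of a realization of `g^* τ` is an `F`-deflation, and its composite with `g` is an
`F`-deflation that kills `τ`. -/
theorem IsNExangulated.mem_of_pull_mem (h : IsNExangulated n E s) (hn : 1 ≤ n)
    (hF : ∀ {A B C : 𝓒} (f : A ⟶ B) (g : B ⟶ C), IsDeflation (Conf (F.restrict s)) f →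
      IsDeflation (Conf (F.restrict s)) g → IsDeflation (Conf (F.restrict s)) (f ≫ g))
    {A B C : 𝓒} {g : B ⟶ C} (hg : IsDeflation (Conf (F.restrict s)) g)
    (τ : Ext E C A) (hτ : pull E g τ ∈ F.grp B A) : τ ∈ F.grp C A := by
  obtain ⟨P, hP⟩ := Quotient.exists_rep (s (pull E g τ))
  refine h.mem_of_pull_eq_zero hn (hF P.defl g (P.isDeflation_defl ?_) hg) τ ?_
  · exact (F.conf_restrict_iff P).2 ⟨_, hτ, hP.symm⟩
  · rw [pull_comp, (h.exangle _ P hP.symm).pull_defl]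

/-- Let `τ` be the extension of the inflation `f ≫ g`. Then `g` kills `f_* τ`, so `f_* τ` lies in
`F`. Its deflation `p` satisfies `f_* p^* τ = p^* f_* τ = 0`, so `p^* τ` lies in `F`, and membership
descends along the `F`-deflation `p`. -/
theorem IsNExangulated.isInflation_comp_restrict (h : IsNExangulated n E s) (hn : 1 ≤ n)
    (hF : ∀ {A B C : 𝓒} (f : A ⟶ B) (g : B ⟶ C), IsDeflation (Conf (F.restrict s)) f →
      IsDeflation (Conf (F.restrict s)) g → IsDeflation (Conf (F.restrict s)) (f ≫ g))
    {A B C : 𝓒} (f : A ⟶ B) (g : B ⟶ C)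
    (hf : IsInflation (Conf (F.restrict s)) f) (hg : IsInflation (Conf (F.restrict s)) g) :
    IsInflation (Conf (F.restrict s)) (f ≫ g) := by
  obtain ⟨D, T, e, ⟨τ, hτ⟩, he⟩ := h.inflation_comp f g (F.isInflation_of_restrict hf)
    (F.isInflation_of_restrict hg)
  refine ⟨D, T, e, (F.conf_restrict_iff T).2 ⟨τ, ?_, hτ⟩, he⟩
  have hσ : push E f τ ∈ F.grp D B := by
    refine h.mem_of_push_eq_zero hn hg _ ?_
    rw [← push_comp, ← he, push_comp, (h.exangle τ T hτ).push_inf, push_map_zero]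
  obtain ⟨Z, hZ⟩ := Quotient.exists_rep (s (push E f τ))
  refine h.mem_of_pull_mem hn hF
    (Z.isDeflation_defl ((F.conf_restrict_iff Z).2 ⟨_, hσ, hZ.symm⟩)) τ ?_
  refine h.mem_of_push_eq_zero hn hf _ ?_
  rw [push_pull, (h.exangle _ Z hZ.symm).pull_defl]

/-- The restriction of an `n`-exangulated structure to an additive subfunctor whose deflations are
closed under composition is `n`-exangulated. -/
theorem IsNExangulated.restrict (h : IsNExangulated n E s) (hn : 1 ≤ n)
    (hF : ∀ {A B C : 𝓒} (f : A ⟶ B) (g : B ⟶ C), IsDeflation (Conf (F.restrict s)) f →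
      IsDeflation (Conf (F.restrict s)) g → IsDeflation (Conf (F.restrict s)) (f ≫ g)) :
    IsNExangulated n F.toBifunctor (F.restrict s) where
  additive_left := by
    have := h.additive_left
    refine ⟨fun {C C' f g} => ?_⟩
    ext A δ
    exact Subtype.ext (add_pull (E := E) f.unop g.unop δ.1)
  additive_right C := by
    have := h.additive_right
    refine ⟨fun {A A' f g} => ?_⟩
    ext δ
    exact Subtype.ext (add_push (E := E) f g δ.1)
  exists_lift δ ρ X Y hX hY a c hac :=
    h.exists_lift δ.1 ρ.1 X Y hX hY a c (congrArg Subtype.val hac)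
  exangle δ X hX := by
    have hE := h.exangle δ.1 X hX
    refine ⟨hE.cov, fun W g => Iff.trans ?_ (hE.cov_last W g), hE.contra,
      fun W g => Iff.trans ?_ (hE.contra_last W g)⟩
    · exact Subtype.ext_iff
    · exact Subtype.ext_iff
  split_left hZ X h₁ h₂ := h.split_left hZ X h₁ h₂
  split_right hZ X h₁ h₂ := h.split_right hZ X h₁ h₂
  inflation_comp := h.isInflation_comp_restrict hn hF
  deflation_comp := hF
  -- The lift of the ambient structure serves unchanged: the extension of its cone is a pushout of a
  -- pullback of `ρ`, so it lies in `F`.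
  good_lift ρ c X Y hX hY := h.good_lift ρ.1 c X Y hX hY
  good_lift_op ρ a X Y hX hY := h.good_lift_op ρ.1 a X Y hX hY

end Restriction

/-! ### Proper classes and subfunctors -/

section Proper

variable {𝓒 : Type u} [Category.{v} 𝓒] [Preadditive 𝓒] [HasBinaryBiproducts 𝓒] {n : ℕ}
  {E : 𝓒ᵒᵖ ⥤ 𝓒 ⥤ AddCommGrpCat.{w}} {s : Corr n E} {ξ : ExangleClass n E}

/-- The Baer sum formula, which derives closure of `E_ξ` under addition from direct sums and
(co)base change. -/
theorem extSum_diag {A C : 𝓒} (δ δ' : Ext E C A) :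
    push E (biprod.desc (𝟙 A) (𝟙 A)) (pull E (biprod.lift (𝟙 C) (𝟙 C)) (extSum E δ δ')) =
      δ + δ' := by
  simp only [extSum, pull_map_add, push_map_add, ← pull_comp, biprod.lift_fst, biprod.lift_snd,
    pull_id, ← push_comp, biprod.inl_desc, biprod.inr_desc, push_id]

/-- The additive subfunctor of the extensions realized by a member of an `n`-proper class. -/
def IsNProper.subfunctor (h : IsNExangulated n E s) (hξ : IsNProper s ξ) : AddSubBifunctor E :=
  have push_mem : ∀ {C A A' : 𝓒} (a : A ⟶ A') (δ : Ext E C A), (∃ X : NSeq n A C, ξ X δ) →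
      ∃ X : NSeq n A' C, ξ X (push E a δ) := fun a δ ⟨X, hX⟩ =>
    let ⟨Y, hY⟩ := Quotient.exists_rep (s (push E a δ))
    ⟨Y, hξ.cobase_change X δ a Y hX hY.symm⟩
  have pull_mem : ∀ {C C' A : 𝓒} (c : C' ⟶ C) (δ : Ext E C A), (∃ X : NSeq n A C, ξ X δ) →
      ∃ X : NSeq n A C', ξ X (pull E c δ) := fun c δ ⟨X, hX⟩ =>
    let ⟨Y, hY⟩ := Quotient.exists_rep (s (pull E c δ))
    ⟨Y, hξ.base_change X δ c Y hX hY.symm⟩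
  { grp := fun C A =>
      { carrier := {δ | ∃ X : NSeq n A C, ξ X δ}
        zero_mem' := by
          obtain ⟨X, hX⟩ := Quotient.exists_rep (s (0 : Ext E C A))
          exact ⟨X, hξ.split_mem X hX.symm⟩
        add_mem' := by
          rintro δ δ' ⟨X, hX⟩ ⟨Y, hY⟩
          rw [← extSum_diag]
          exact push_mem _ _ (pull_mem _ _ ⟨_, hξ.sum_mem X δ Y δ' hX hY⟩)
        neg_mem' := by
          intro δ hδ
          have := h.additive_right
          have e : push E (-𝟙 A) δ = -δ := by
            rw [eq_neg_iff_add_eq_zero]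
            nth_rw 2 [← push_id δ]
            rw [← add_push, neg_add_cancel, zero_push]
          rw [← e]
          exact push_mem _ _ hδ }
    push_mem := push_mem
    pull_mem := pull_mem }

/-- A lift of the identities between two realizations of `δ` is a weak isomorphism, so membership in
`ξ` depends on `δ` only. -/
theorem ClosedUnderWeakIso.mem_of_realize (h : IsNExangulated n E s)
    (hw : ClosedUnderWeakIso s ξ) {A C : 𝓒} {X Y : NSeq n A C} {δ : Ext E C A}
    (hX : s δ = ⟦X⟧) (hY : s δ = ⟦Y⟧) (hξ : ξ X δ) : ξ Y δ := by
  obtain ⟨f, hf⟩ := h.exists_lift δ δ X Y hX hY (𝟙 A) (𝟙 C) (by simp)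
  exact (hw X δ Y δ hX hY f _ _ hf (by simp) inferInstance inferInstance).1 hξ

theorem seqs_iff_conf_restrict (h : IsNExangulated n E s)
    (hd : ∀ {A C : 𝓒} (X : NSeq n A C) (δ : Ext E C A), ξ X δ → s δ = ⟦X⟧)
    (hw : ClosedUnderWeakIso s ξ) {F : AddSubBifunctor E} (hF : IsSubfunctorOf ξ F) {A C : 𝓒}
    (X : NSeq n A C) : ξ.seqs X ↔ Conf (F.restrict s) X := by
  rw [F.conf_restrict_iff]
  constructor
  · rintro ⟨δ, hδ⟩
    exact ⟨δ, (hF _ _ _).2 ⟨X, hδ⟩, hd X δ hδ⟩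
  · rintro ⟨δ, hδ, hX⟩
    obtain ⟨Y, hY⟩ := (hF _ _ _).1 hδ
    exact ⟨δ, hw.mem_of_realize h (hd Y δ hY) hX hY⟩

theorem isDeflation_seqs_iff (h : IsNExangulated n E s)
    (hd : ∀ {A C : 𝓒} (X : NSeq n A C) (δ : Ext E C A), ξ X δ → s δ = ⟦X⟧)
    (hw : ClosedUnderWeakIso s ξ) {F : AddSubBifunctor E} (hF : IsSubfunctorOf ξ F) {B C : 𝓒}
    (g : B ⟶ C) : IsDeflation ξ.seqs g ↔ IsDeflation (Conf (F.restrict s)) g := by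
  simp only [IsDeflation, seqs_iff_conf_restrict h hd hw hF]

/-- A class of distinguished `n`-exangles closed under weak isomorphisms is `n`-proper if and only
if it induces an `n`-exangulated structure. -/
theorem isNProper_iff_restriction (h : IsNExangulated n E s) (hn : 1 ≤ n)
    (hd : ∀ {A C : 𝓒} (X : NSeq n A C) (δ : Ext E C A), ξ X δ → s δ = ⟦X⟧)
    (hw : ClosedUnderWeakIso s ξ) : IsNProper s ξ ↔ RestrictionIsNExangulated s ξ := by
  constructor
  · intro hξ
    have hF : IsSubfunctorOf ξ (hξ.subfunctor h) := fun _ _ _ => Iff.rfl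
    refine ⟨hξ.subfunctor h, hF, h.restrict hn fun {A _ _} f g hf hg => ?_⟩
    have hf' := (hξ.subfunctor h).isDeflation_of_restrict hf
    have hg' := (hξ.subfunctor h).isDeflation_of_restrict hg
    rw [← isDeflation_seqs_iff h hd hw hF] at hf hg ⊢
    -- Saturation for the square whose left edge is the identity of `A`.
    exact hξ.saturated f g (𝟙 A) (f ≫ g) (by simp) hf' hg' (h.deflation_comp f g hf' hg') hf hg
  · rintro ⟨F, hF, hFn⟩
    have mem : ∀ {A C : 𝓒} {X : NSeq n A C} {δ : Ext E C A}, δ ∈ F.grp C A → s δ = ⟦X⟧ → ξ X δ := by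
      intro A C X δ hδ hX
      obtain ⟨Y, hY⟩ := (hF _ _ _).1 hδ
      exact hw.mem_of_realize h (hd Y δ hY) hX hY
    have mem' : ∀ {A C : 𝓒} {X : NSeq n A C} {δ : Ext E C A}, ξ X δ → δ ∈ F.grp C A :=
      fun hX => (hF _ _ _).2 ⟨_, hX⟩
    refine ⟨hd, fun X hX => mem (F.grp _ _).zero_mem hX, hw, ?_, ?_, ?_, ?_⟩
    · intro A C A' C' X δ Y ρ hX hY
      refine mem ?_ (h.realize_sum (hd X δ hX) (hd Y ρ hY))
      exact (F.grp _ _).add_mem (F.pull_mem _ _ (F.push_mem _ _ (mem' hX)))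
        (F.pull_mem _ _ (F.push_mem _ _ (mem' hY)))
    · exact fun X δ c Y hX hY => mem (F.pull_mem _ _ (mem' hX)) hY
    · exact fun X δ a Y hX hY => mem (F.push_mem _ _ (mem' hX)) hY
    · intro A B C D a b c d hac _ _ hd' ha hb
      rw [isDeflation_seqs_iff h hd hw hF] at ha hb ⊢
      obtain ⟨K, X, e, ⟨δ, hδ⟩, rfl⟩ := hd'
      refine ⟨K, X, e, (F.conf_restrict_iff X).2 ⟨δ, ?_, hδ⟩, rfl⟩
      -- The extension `δ` of `d` is killed by `d`, hence by `c ≫ d = a ≫ b`, which is a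
      -- `ξ`-deflation.
      refine h.mem_of_pull_eq_zero hn (hFn.deflation_comp a b ha hb) δ ?_
      rw [hac, pull_comp, pull_comp, (h.exangle δ X hδ).pull_defl, pull_map_zero, pull_map_zero]

end Proper

/-! ### Substructures of `n`-exact categories -/

section NExactStructures

variable {𝓒 : Type u} [Category.{v} 𝓒] [Preadditive 𝓒] {n : ℕ}

theorem LeftNExact.mono_d {A C : 𝓒} {X : NSeq n A C} (hX : LeftNExact X) : Mono (X.K.d 0 1) := by
  have := hX.mono
  have e : X.K.d 0 1 = X.α.hom ≫ X.inf := by simp [NSeq.inf]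
  rw [e]
  infer_instance

theorem RightNExact.epi_d {A C : 𝓒} {X : NSeq n A C} (hX : RightNExact X) :
    Epi (X.K.d n (n + 1)) := by
  have := hX.epi
  have e : X.K.d n (n + 1) = X.defl ≫ X.γ.inv := by simp [NSeq.defl]
  rw [e]
  infer_instance

/-- A morphism of complexes into an `n`-kernel that vanishes in the last degree factors through the
first differential in degree `0`. -/
theorem LeftNExact.exists_factor {A C : 𝓒} {Y : NSeq n A C} (hY : LeftNExact Y)
    {K : CochainComplex 𝓒 ℕ} (u : K ⟶ Y.K) (hu : u.f (n + 1) = 0) :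
    ∃ k : K.X 1 ⟶ Y.K.X 0, u.f 0 = K.d 0 1 ≫ k := by
  have key : ∀ j, j ≤ n → ∃ k : K.X (j + 1) ⟶ Y.K.X j,
      (u.f j - K.d j (j + 1) ≫ k) ≫ Y.K.d j (j + 1) = 0 := by
    -- A homotopy is built downwards from degree `n`, where `0` works because `u` vanishes in degree
    -- `n + 1`. In degree `0` the monomorphism `d⁰` is cancelled.
    refine fun j hj => Nat.decreasingInduction (n := n)
      (motive := fun j _ => ∃ k : K.X (j + 1) ⟶ Y.K.X j,
        (u.f j - K.d j (j + 1) ≫ k) ≫ Y.K.d j (j + 1) = 0) ?_ ⟨0, by simp [hu]⟩ hj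
    rintro j hj ⟨k, hk⟩
    obtain ⟨k', hk'⟩ := hY.exact _ j hj _ hk
    refine ⟨k', ?_⟩
    rw [Preadditive.sub_comp, Category.assoc, hk', u.comm]
    simp
  obtain ⟨k, hk⟩ := key 0 (Nat.zero_le n)
  have := hY.mono_d
  rw [← zero_comp (f := Y.K.d 0 1), cancel_mono, sub_eq_zero] at hk
  exact ⟨k, hk⟩

/-- A morphism `f` between `n`-kernels with two consecutive invertible components is split
injective in degree `0` up to homotopy. -/
theorem exists_retraction_left {A C A' C' : 𝓒} {X : NSeq n A C} {Y : NSeq n A' C'}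
    (hX : LeftNExact X) (f : X.K ⟶ Y.K) {k : ℕ} (hk : k ≤ n) (h₀ : IsIso (f.f k))
    (h₁ : IsIso (f.f (k + 1))) :
    ∃ (g : Y.K.X 0 ⟶ X.K.X 0) (t : X.K.X 1 ⟶ X.K.X 0), 𝟙 _ = f.f 0 ≫ g + X.K.d 0 1 ≫ t := by
  have key : ∀ j, j ≤ k → ∃ (g : Y.K.X j ⟶ X.K.X j) (t : X.K.X (j + 1) ⟶ X.K.X j),
      (𝟙 _ - f.f j ≫ g - X.K.d j (j + 1) ≫ t) ≫ X.K.d j (j + 1) = 0 ∧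
        ∀ {W : 𝓒} (z : W ⟶ Y.K.X j), z ≫ Y.K.d j (j + 1) = 0 → z ≫ g ≫ X.K.d j (j + 1) = 0 := by
    -- Descent from degree `k`, starting with the inverse of `f.f k`. The second clause, that `g ≫
    -- d` kills whatever `d` kills, replaces a chain map condition on `g`: applied to the incoming
    -- differential of `Y`, it allows `g` to be lifted one degree down. At the start it uses the
    -- inverse of `f.f (k + 1)`.
    refine fun j hj => Nat.decreasingInduction (n := k)
      (motive := fun j _ => ∃ (g : Y.K.X j ⟶ X.K.X j) (t : X.K.X (j + 1) ⟶ X.K.X j),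
      (𝟙 _ - f.f j ≫ g - X.K.d j (j + 1) ≫ t) ≫ X.K.d j (j + 1) = 0 ∧
        ∀ {W : 𝓒} (z : W ⟶ Y.K.X j), z ≫ Y.K.d j (j + 1) = 0 → z ≫ g ≫ X.K.d j (j + 1) = 0)
      ?_ ⟨inv (f.f k), 0, by simp, ?_⟩ hj
    · rintro j hj ⟨g, t, h1, h2⟩
      obtain ⟨g', hg'⟩ := hX.exact _ j (by omega) (Y.K.d j (j + 1) ≫ g)
        (by rw [Category.assoc]; exact h2 _ (by simp))
      obtain ⟨t', ht'⟩ := hX.exact _ j (by omega) _ h1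
      refine ⟨g', t', ?_, fun z hz => ?_⟩
      · simp only [Preadditive.sub_comp, Category.assoc, hg', ht', HomologicalComplex.Hom.comm_assoc,
          Preadditive.comp_sub, Category.id_comp, Category.comp_id,
          HomologicalComplex.d_comp_d_assoc, zero_comp]
        abel
      · rw [hg', reassoc_of% hz, zero_comp]
    · intro W z hz
      have e : inv (f.f k) ≫ X.K.d k (k + 1) = Y.K.d k (k + 1) ≫ inv (f.f (k + 1)) := by
        rw [IsIso.inv_comp_eq, ← Category.assoc, IsIso.eq_comp_inv, f.comm]
      rw [e, reassoc_of% hz, zero_comp]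
  obtain ⟨g, t, h1, -⟩ := key 0 (Nat.zero_le k)
  have := hX.mono_d
  rw [← zero_comp (f := X.K.d 0 1), cancel_mono, sub_sub, sub_eq_zero] at h1
  exact ⟨g, t, h1⟩

/-- A morphism `f` between `n`-cokernels with two consecutive invertible components is split
surjective in degree `n + 1` up to homotopy. -/
theorem exists_section_right {A C A' C' : 𝓒} {X : NSeq n A C} {Y : NSeq n A' C'}
    (hY : RightNExact Y) (f : X.K ⟶ Y.K) {k : ℕ} (hk : k ≤ n) (h₀ : IsIso (f.f k))
    (h₁ : IsIso (f.f (k + 1))) :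
    ∃ (g : Y.K.X (n + 1) ⟶ X.K.X (n + 1)) (t : Y.K.X (n + 1) ⟶ Y.K.X n),
      𝟙 _ = g ≫ f.f (n + 1) + t ≫ Y.K.d n (n + 1) := by
  -- The dual construction, ascending from degree `k + 1` to degree `n + 1`.
  have key : ∀ j, k ≤ j → j ≤ n → ∃ (g : Y.K.X (j + 1) ⟶ X.K.X (j + 1))
      (t : Y.K.X (j + 1) ⟶ Y.K.X j),
      Y.K.d j (j + 1) ≫ (𝟙 _ - g ≫ f.f (j + 1) - t ≫ Y.K.d j (j + 1)) = 0 ∧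
        ∀ {W : 𝓒} (z : X.K.X (j + 1) ⟶ W), X.K.d j (j + 1) ≫ z = 0 →
          Y.K.d j (j + 1) ≫ g ≫ z = 0 := by
    intro j hj
    induction j, hj using Nat.le_induction with
    | base =>
      refine fun _ => ⟨inv (f.f (k + 1)), 0, by simp, fun z hz => ?_⟩
      have e : Y.K.d k (k + 1) ≫ inv (f.f (k + 1)) = inv (f.f k) ≫ X.K.d k (k + 1) := by
        rw [IsIso.eq_inv_comp, ← Category.assoc, IsIso.comp_inv_eq, f.comm]
      rw [reassoc_of% e, hz, comp_zero]
    | succ j hj ih =>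
      intro hjn
      obtain ⟨g, t, h1, h2⟩ := ih (by omega)
      obtain ⟨g', hg'⟩ := hY.exact _ j (by omega) (g ≫ X.K.d (j + 1) (j + 2)) (h2 _ (by simp))
      obtain ⟨t', ht'⟩ := hY.exact _ j (by omega) _ h1
      refine ⟨g', t', ?_, fun z hz => ?_⟩
      · simp only [Preadditive.comp_sub, reassoc_of% hg', reassoc_of% ht',
          ← HomologicalComplex.Hom.comm, Preadditive.sub_comp, Category.id_comp, Category.comp_id,
          Category.assoc, HomologicalComplex.d_comp_d, comp_zero]
        abel
      · rw [reassoc_of% hg', hz, comp_zero]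
  obtain ⟨g, t, h1, -⟩ := key n hk le_rfl
  have := hY.epi_d
  rw [← comp_zero (f := Y.K.d n (n + 1)), cancel_epi, sub_sub, sub_eq_zero] at h1
  exact ⟨g, t, h1⟩

variable [HasBinaryBiproducts 𝓒] {E : 𝓒ᵒᵖ ⥤ 𝓒 ⥤ AddCommGrpCat.{w}} {s : Corr n E}

/-- If the inflation of the target is an `n`-kernel, then every morphism of complexes between
distinguished `n`-exangles is a morphism of `n`-exangles. -/
theorem IsNExangulated.push_eq_pull_of_lifts (h : IsNExangulated n E s) (hn : 1 ≤ n)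
    {A C A' C' : 𝓒} {X : NSeq n A C} {Y : NSeq n A' C'} {δ : Ext E C A} {ρ : Ext E C' A'}
    (hX : s δ = ⟦X⟧) (hY : s ρ = ⟦Y⟧) (hYl : LeftNExact Y) {f : X.K ⟶ Y.K} {a : A ⟶ A'}
    {c : C ⟶ C'} (hf : NSeq.Lifts (X := X) (Y := Y) f a c) : push E a δ = pull E c ρ := by
  have := h.additive_right
  have hc : X.defl ≫ c = f.f n ≫ Y.defl := by
    simp [NSeq.defl, ← hf.right]
  -- Since `c^* ρ` is killed by `X.defl`, it is `b_* δ` for some `b`. A lift `g` of `(b, c)` agrees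
  -- with `f` in degree `n + 1`, so `a - b` factors through `X.inf`, which kills `δ`; hence `a_* δ =
  -- b_* δ`.
  obtain ⟨b, hb⟩ := h.exists_push_eq hn hX (pull E c ρ) (by
    rw [← pull_comp, hc, pull_comp, (h.exangle ρ Y hY).pull_defl, pull_map_zero])
  obtain ⟨g, hg⟩ := h.exists_lift δ ρ X Y hX hY b c hb
  obtain ⟨k, hk⟩ := hYl.exists_factor (f - g) (by
    rw [← cancel_mono Y.γ.hom]
    simp [hf.right, hg.right])
  have hab : a = b + X.inf ≫ k ≫ Y.α.hom := by
    rw [← cancel_epi X.α.hom, Preadditive.comp_add, ← hf.left, ← hg.left, ← sub_eq_iff_eq_add',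
      ← Preadditive.sub_comp, ← HomologicalComplex.sub_f_apply, hk]
    simp [NSeq.inf]
  rw [hab, add_push, push_comp, (h.exangle δ X hX).push_inf, push_map_zero, add_zero, hb]

variable {F : AddSubBifunctor E}

/-- The identity of `C'` factors through `c` up to a map through `Y.defl`, which kills `ρ`. So `ρ`
is a pullback of `c^* ρ = a_* δ`. Dually, `δ` is a pushout of `a_* δ = c^* ρ`. -/
theorem IsNExangulated.mem_iff_mem_of_jassoWeakIso (h : IsNExangulated n E s) (hn : 1 ≤ n)
    {A C A' C' : 𝓒} {X : NSeq n A C} {Y : NSeq n A' C'} {δ : Ext E C A} {ρ : Ext E C' A'}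
    (hX : s δ = ⟦X⟧) (hY : s ρ = ⟦Y⟧) (hXe : IsNExactSeq X) (hYe : IsNExactSeq Y)
    {f : X.K ⟶ Y.K} (hf : JassoWeakIso (X := X) (Y := Y) f) :
    δ ∈ F.grp C A ↔ ρ ∈ F.grp C' A' := by
  have := h.additive_left
  have := h.additive_right
  let a : A ⟶ A' := X.α.inv ≫ f.f 0 ≫ Y.α.hom
  let c : C ⟶ C' := X.γ.inv ≫ f.f (n + 1) ≫ Y.γ.hom
  have hac : push E a δ = pull E c ρ :=
    h.push_eq_pull_of_lifts hn hX hY hYe.1 (f := f) ⟨by simp [a], by simp [c]⟩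
  have hl : ∃ (g : Y.K.X 0 ⟶ X.K.X 0) (t : X.K.X 1 ⟶ X.K.X 0),
      𝟙 _ = f.f 0 ≫ g + X.K.d 0 1 ≫ t := by
    rcases hf with ⟨k, hk, h₀, h₁⟩ | ⟨_, h₀⟩
    · exact exists_retraction_left hXe.1 f hk h₀ h₁
    · exact ⟨inv (f.f 0), 0, by simp⟩
  have hr : ∃ (g : Y.K.X (n + 1) ⟶ X.K.X (n + 1)) (t : Y.K.X (n + 1) ⟶ Y.K.X n),
      𝟙 _ = g ≫ f.f (n + 1) + t ≫ Y.K.d n (n + 1) := by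
    rcases hf with ⟨k, hk, h₀, h₁⟩ | ⟨h₀, _⟩
    · exact exists_section_right hYe.2 f hk h₀ h₁
    · exact ⟨inv (f.f (n + 1)), 0, by simp⟩
  constructor
  · intro hδ
    obtain ⟨g, t, e⟩ := hr
    have e' : 𝟙 C' = (Y.γ.inv ≫ g ≫ X.γ.hom) ≫ c + (Y.γ.inv ≫ t) ≫ Y.defl := by
      have := congrArg (fun z => Y.γ.inv ≫ z ≫ Y.γ.hom) e
      simpa [NSeq.defl, c] using this
    rw [← pull_id ρ, e', add_pull, pull_comp, pull_comp _ Y.defl,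
      (h.exangle ρ Y hY).pull_defl, pull_map_zero, add_zero, ← hac]
    exact F.pull_mem _ _ (F.push_mem _ _ hδ)
  · intro hρ
    obtain ⟨g, t, e⟩ := hl
    have e' : 𝟙 A = a ≫ Y.α.inv ≫ g ≫ X.α.hom + X.inf ≫ t ≫ X.α.hom := by
      have := congrArg (fun z => X.α.inv ≫ z ≫ X.α.hom) e
      simpa [NSeq.inf, a] using this
    rw [← push_id δ, e', add_push, push_comp, push_comp X.inf,
      (h.exangle δ X hX).push_inf, push_map_zero, add_zero, hac]
    exact F.push_mem _ _ (F.pull_mem _ _ hρ)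

/-- An `n`-exangulated substructure of an `n`-exact category is `n`-exact. -/
theorem IsNExact.restrict (h : IsNExact n E s) (hn : 1 ≤ n)
    (hF : IsNExangulated n F.toBifunctor (F.restrict s)) :
    IsNExact n F.toBifunctor (F.restrict s) where
  exangulated := hF
  injective A C := fun δ ρ hδρ => Subtype.ext (h.injective A C hδρ)
  nExact :=
    { nExact := fun X hX => h.nExact.nExact X (F.conf_of_restrict hX)
      weakIso := by
        intro A C A' C' X Y hXe hYe f hf
        simp only [F.conf_restrict_iff]
        constructor
        · rintro ⟨δ, hδ, hX⟩
          obtain ⟨ρ, hY⟩ := (h.nExact.weakIso X Y hXe hYe f hf).1 ⟨δ, hX⟩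
          exact ⟨ρ, (h.exangulated.mem_iff_mem_of_jassoWeakIso hn hX hY hXe hYe hf).1 hδ, hY⟩
        · rintro ⟨ρ, hρ, hY⟩
          obtain ⟨δ, hX⟩ := (h.nExact.weakIso X Y hXe hYe f hf).2 ⟨ρ, hY⟩
          exact ⟨δ, (h.exangulated.mem_iff_mem_of_jassoWeakIso hn hX hY hXe hYe hf).2 hρ, hX⟩
      zero := by
        intro A C X hX
        obtain ⟨δ, hδ⟩ := h.nExact.zero X hX
        have hC : IsZero C := (hX (n + 1)).of_iso X.γ.symm
        have := h.exangulated.additive_left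
        have h0 : δ = 0 := by rw [← pull_id δ, hC.eq_of_src (𝟙 C) 0, zero_pull]
        exact (F.conf_restrict_iff X).2 ⟨δ, h0 ▸ (F.grp C A).zero_mem, hδ⟩
      mono_comp := hF.inflation_comp
      epi_comp := hF.deflation_comp
      pushout := by
        rintro A C X ⟨δ, hX⟩ B a
        obtain ⟨Y, hY⟩ := Quotient.exists_rep (F.restrict s (push F.toBifunctor a δ))
        -- The `n`-pushout comes from a good lift: its cocone is a conflation, hence `n`-exact.
        obtain ⟨φ, hφ, N, hN⟩ := hF.good_lift_op δ a X Y hX hY.symm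
        exact ⟨Y.K, φ, Y.α, N, hφ.left,
          (h.nExact.nExact N.seq (F.conf_of_restrict ⟨_, hN⟩)).2,
          Y.isInflation_inf ⟨_, hY.symm⟩⟩
      pullback := by
        rintro A C X ⟨δ, hX⟩ B c
        obtain ⟨Y, hY⟩ := Quotient.exists_rep (F.restrict s (pull F.toBifunctor c δ))
        obtain ⟨φ, hφ, M, hM⟩ := hF.good_lift δ c Y X hY.symm hX
        exact ⟨Y.K, φ, Y.γ, M, hφ.right,
          (h.nExact.nExact M.seq (F.conf_of_restrict ⟨_, hM⟩)).1,
          Y.isDeflation_defl ⟨_, hY.symm⟩⟩ }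

end NExactStructures

end NExang

theorem corollary4p6 {𝓒 : Type u} [CategoryTheory.Category.{v} 𝓒]
    [CategoryTheory.Preadditive 𝓒] [CategoryTheory.Limits.HasZeroObject 𝓒]
    [CategoryTheory.Limits.HasBinaryBiproducts 𝓒]
    (n : ℕ) (hn : 1 ≤ n) (E : 𝓒ᵒᵖ ⥤ 𝓒 ⥤ AddCommGrpCat.{w}) (s : NExang.Corr n E)
    (h : NExang.IsNExangulated n E s) :
    (NExang.IsNExact n E s →
      ∀ ξ : NExang.SeqClass 𝓒 n,
        (∀ ⦃A C : 𝓒⦄ (X : NExang.NSeq n A C), ξ X → NExang.Conf s X) →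
        NExang.ClosedUnderWeakIso s (NExang.inducedClass s ξ) →
        (NExang.IsNProper s (NExang.inducedClass s ξ) ↔
          NExang.RestrictionIsNExact s (NExang.inducedClass s ξ))) ∧
    (∀ P : NExang.AngulatedPresentation n E s,
      ∀ ξ : NExang.SigmaSeq n P.S → Prop,
        (∀ T, ξ T → P.Θ T) →
        NExang.ClosedUnderWeakIso s (P.inducedClass ξ) →
        (NExang.IsNProper s (P.inducedClass ξ) ↔
          NExang.RestrictionIsNExangulated s (P.inducedClass ξ))) := by
  refine ⟨fun hE ξ _ hw => ?_, fun P ξ _ hw => ?_⟩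
  -- For substructures of an `n`-exact category, being `n`-exangulated and being `n`-exact coincide.
  · rw [NExang.isNProper_iff_restriction h hn (fun _ _ hX => hX.1) hw]
    exact ⟨fun ⟨F, hF, hFn⟩ => ⟨F, hF, hE.restrict hn hFn⟩,
      fun ⟨F, hF, hFn⟩ => ⟨F, hF, hFn.exangulated⟩⟩
  · exact NExang.isNProper_iff_restriction h hn (fun _ _ hX => hX.1) hw
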